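/- **Theorem 2.** There is a universal constant $C>0$ such that the following holds. *Setting.* Let $\mathcal X$ be a finite set and let $\mathcal H$ be a reproducing kernel Hilbert space of real functions on $\mathcal X$ with kernel $k$ satisfying $k(x,x)\le 1$ for all $x$. Let $f\in\mathcal H$ with $\|f\|_{\mathcal H}\le B$. Assume that $f$ has a unique maximizer $x^*$ and that $|\mathcal X|\ge 2$. Write $\Delta(x)=f(x^*)-f(x)$ and $\Delta_{\min}=\min_{x\ne x^*}\Delta(x)$. Let $\rho\ge 0$, $\lambda\ge 1$ and $\delta\in(0,1)$. *Regression.* In round $t=1,2,\dots$ let $(x_s^1,x_s^2)$, $s<t$, be the pairs played so far and $d_s$ the feedback values, and put $$[K_t]_{ij}=k(x_i^1,x_j^1)-k(x_i^1,x_j^2)-k(x_i^2,x_j^1)+k(x_i^2,x_j^2),\qquad [k_t(x)]_i=k(x,x_i^1)-k(x,x_i^2)\quad(i,j<t),$$ $$\hat f_t=\operatorname*{argmin}_{h\in\mathcal H}\ \sum_{s=1}^{t-1}\big(h(x_s^1)-h(x_s^2)-d_s\big)^2+\lambda\|h\|_{\mathcal H}^2,\qquad k_t(x,y)=k(x,y)-k_t(x)^\top(K_t+\lambda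 I)^{-1}k_t(y),$$ $$\psi_t(x,z)=k_t(x,x)+k_t(z,z)-2k_t(x,z),\qquad I_t(x,z)=\log\big(1+\psi_t(x,z)\big),$$ $$\beta_{t,\delta}^{1/2}=\rho\sqrt{\log\det(I+\lambda^{-1}K_t)+2\log\tfrac1\delta}+\sqrt\lambda\,B .$$ *Algorithm 1 (approximate information-directed sampling).* In round $t$ let $\hat x_t^*\in\operatorname*{argmax}_x\hat f_t(x)$ and $$\delta_t=\max_{z\in\mathcal X}\Big(\hat f_t(z)-\hat f_t(\hat x^*_t)+\beta_{t,\delta}^{1/2}\psi_t(\hat x_t^*,z)^{1/2}\Big),\qquad \hat\Delta_t(x)=\delta_t+\hat f_t(\hat x_t^*)-\hat f_t(x),$$ $$(z_t,p_t)\in\operatorname*{argmin}_{z\in\mathcal X,\ p\in[0,1]}\frac{\big((1-p)\delta_t+p\,\hat\Delta_t(z)\big)^2}{p\,I_t(\hat x_t^*,z)},$$ where $a/0=\infty$ for $a>0$ and $0/0=0$; ties are broken in any non-anticipating way. Draw $B_t\in\{0,1\}$ with $\Pr(B_t=1\mid\text{past})=p_t$. If $B_t=1$, play $(x_t^1,x_t^2)=(\hat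 x_t^*,z_t)$ and observe $d_t=f(x_t^1)-f(x_t^2)+\xi_t$; if $B_t=0$, play $(x_t^1,x_t^2)=(\hat x_t^*,\hat x_t^*)$ without feedback (the value of $d_t$ then has no influence). The noise $\xi_t$ is $\rho^2$-sub-Gaussian conditionally on the past and on the pair played in round $t$: $\mathbb E[e^{\eta\xi_t}\mid\cdot]\le e^{\eta^2\rho^2/2}$ for all $\eta\in\mathbb R$. *Conclusion.* For every $n\ge1$, with probability at least $1-\delta$, $$R^{\mathrm{duel}}_n=\sum_{t=1}^n\big(\Delta(x_t^1)+\Delta(x_t^2)\big)\ \le\ \frac{C}{\Delta_{\min}}\,\beta_{n,\delta}\Big(\gamma_n+\log\frac n\delta\Big),\qquad \gamma_n=\sum_{t=1}^nI_t(x_t^1,x_t^2).$$ -/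

import Mathlib

open MeasureTheory ProbabilityTheory
open scoped ENNReal Matrix

noncomputable section

namespace DuelingIDS

/-! ## Kernel regression from dueling data

Rounds are numbered `0, 1, 2, …`, so that exactly `t` pairs `(x1 s, x2 s)`, `s < t`, have been
played before round `t`.  `H` is a reproducing kernel Hilbert space of real functions on `X`. -/

section Regression

variable {X : Type*} (H : Type*) [NormedAddCommGroup H] [InnerProductSpace ℝ H] [CompleteSpace H]
  [RKHS ℝ H X ℝ]

/-- The scalar reproducing kernel `k(x, y)` of `H`. -/
def kern (x y : X) : ℝ := RKHS.kernel H x y 1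

/-- The `t × t` kernel matrix of the first `t` pairs. -/
def gram (x1 x2 : ℕ → X) (t : ℕ) : Matrix (Fin t) (Fin t) ℝ :=
  Matrix.of fun i j =>
    kern H (x1 i) (x1 j) - kern H (x1 i) (x2 j) - kern H (x2 i) (x1 j) + kern H (x2 i) (x2 j)

/-- The vector `k_t(x)`. -/
def kvec (x1 x2 : ℕ → X) (t : ℕ) (x : X) : Fin t → ℝ :=
  fun i => kern H x (x1 i) - kern H x (x2 i)

/-- The posterior kernel `k_t(x, y) = k(x, y) - k_t(x)ᵀ (K_t + λ I)⁻¹ k_t(y)`. -/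
def postKern (lam : ℝ) (x1 x2 : ℕ → X) (t : ℕ) (x y : X) : ℝ :=
  kern H x y -
    kvec H x1 x2 t x ⬝ᵥ ((gram H x1 x2 t + lam • (1 : Matrix (Fin t) (Fin t) ℝ))⁻¹ *ᵥ
      kvec H x1 x2 t y)

/-- The uncertainty `ψ_t(x, z) = k_t(x, x) + k_t(z, z) - 2 k_t(x, z)` of the reward difference. -/
def psi (lam : ℝ) (x1 x2 : ℕ → X) (t : ℕ) (x z : X) : ℝ :=
  postKern H lam x1 x2 t x x + postKern H lam x1 x2 t z z - 2 * postKern H lam x1 x2 t x z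

/-- The information gain `I_t(x, z) = log (1 + ψ_t(x, z))`. -/
def infoGain (lam : ℝ) (x1 x2 : ℕ → X) (t : ℕ) (x z : X) : ℝ :=
  Real.log (1 + psi H lam x1 x2 t x z)

/-- The square root of the confidence coefficient,
`ρ √(log det (I + λ⁻¹ K_t) + 2 log (1/δ)) + √λ B`. -/
def betaSqrt (lam rho B delta : ℝ) (x1 x2 : ℕ → X) (t : ℕ) : ℝ :=
  rho * √(Real.log (1 + lam⁻¹ • gram H x1 x2 t).det + 2 * Real.log (1 / delta)) + √lam * B

/-- The confidence coefficient computed from the first `t` pairs. -/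
def beta (lam rho B delta : ℝ) (x1 x2 : ℕ → X) (t : ℕ) : ℝ :=
  betaSqrt H lam rho B delta x1 x2 t ^ 2

/-- The total information gain of the rounds `0, …, n - 1`. -/
def totalGain (lam : ℝ) (x1 x2 : ℕ → X) (n : ℕ) : ℝ :=
  ∑ t ∈ Finset.range n, infoGain H lam x1 x2 t (x1 t) (x2 t)

variable {H}

/-- `g` is the kernel least-squares estimator with regularizer `λ` for the first `t` pairs and
feedback values `d`: it minimizes `∑_{s<t} (h(x1 s) - h(x2 s) - d s)² + λ ‖h‖²` over `h ∈ H`. -/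
def IsLeastSquares (lam : ℝ) (x1 x2 : ℕ → X) (d : ℕ → ℝ) (t : ℕ) (g : H) : Prop :=
  IsMinOn
    (fun h : H =>
      (∑ s ∈ Finset.range t, (h (x1 s) - h (x2 s) - d s) ^ 2) + lam * ‖h‖ ^ 2)
    Set.univ g

/-- The largest plausible regret of the empirical maximizer `xhat`, given the estimate `fhat`,
`δ_t = max_z (fhat z - fhat xhat + β_t^{1/2} ψ_t(xhat, z)^{1/2})`
(used for finite `X`, where the supremum is a maximum). -/
def plausibleRegret (lam rho B delta : ℝ) (x1 x2 : ℕ → X) (t : ℕ) (fhat : H) (xhat : X) : ℝ :=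
  ⨆ z : X, (fhat z - fhat xhat +
    betaSqrt H lam rho B delta x1 x2 t * √(psi H lam x1 x2 t xhat z))

/-- The gap estimate `δ_t + fhat xhat - fhat x`. -/
def gapEstimate (lam rho B delta : ℝ) (x1 x2 : ℕ → X) (t : ℕ) (fhat : H) (xhat x : X) : ℝ :=
  plausibleRegret lam rho B delta x1 x2 t fhat xhat + fhat xhat - fhat x

/-- The trade-off `((1-p) δ_t + p gap_t(z))² / (p I_t(xhat, z))`.  The quotient is taken in
`[0, ∞]`, so a positive numerator over `0` is `∞`, while `0 / 0 = 0`. -/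
def idsObjective (lam rho B delta : ℝ) (x1 x2 : ℕ → X) (t : ℕ) (fhat : H) (xhat z : X)
    (p : ℝ) : ℝ≥0∞ :=
  ENNReal.ofReal (((1 - p) * plausibleRegret lam rho B delta x1 x2 t fhat xhat +
      p * gapEstimate lam rho B delta x1 x2 t fhat xhat z) ^ 2) /
    ENNReal.ofReal (p * infoGain H lam x1 x2 t xhat z)

end Regression

/-! ## The algorithm -/

/-- The random quantities of an interaction on the sample space `Ω`; index `t` is the round. -/
structure Interaction (Ω X H : Type*) where
  /-- the least-squares estimate -/
  fhat : ℕ → Ω → H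
  /-- the empirical maximizer -/
  xhat : ℕ → Ω → X
  /-- the challenger -/
  z : ℕ → Ω → X
  /-- the trade-off probability -/
  p : ℕ → Ω → ℝ
  /-- the Bernoulli variable: `true` iff the pair `(xhat, z)` is played -/
  b : ℕ → Ω → Bool
  /-- the observation noise -/
  noise : ℕ → Ω → ℝ

namespace Interaction

variable {Ω X H : Type*} (P : Interaction Ω X H)

/-- The first action of round `t`. -/
def x1 (ω : Ω) (t : ℕ) : X := P.xhat t ω

/-- The second action of round `t`. -/
def x2 (ω : Ω) (t : ℕ) : X := if P.b t ω then P.z t ω else P.xhat t ω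

variable [NormedAddCommGroup H] [InnerProductSpace ℝ H] [CompleteSpace H] [RKHS ℝ H X ℝ]

/-- Quantitative dueling feedback `f(x1) - f(x2) + noise`.  In a round without feedback the value
`0` is only a placeholder: both actions agree, so the least-squares estimate ignores it. -/
def feedback (f : H) (ω : Ω) (t : ℕ) : ℝ :=
  if P.b t ω then f (P.x1 ω t) - f (P.x2 ω t) + P.noise t ω else 0

end Interaction

section Run

variable {Ω X H : Type*} [NormedAddCommGroup H] [InnerProductSpace ℝ H] [CompleteSpace H]
  [RKHS ℝ H X ℝ]

/-- `P` is produced by approximate information-directed sampling with dueling feedback about `f`.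
`ℱ t` is the information available before round `t`; it may be larger than the history of the
learner.  Ties in the two `argmin`/`argmax` steps may be broken in any non-anticipating way. -/
structure IsRun [mΩ : MeasurableSpace Ω] (μ : Measure Ω) (ℱ : Filtration ℕ mΩ) (f : H)
    (lam rho B delta : ℝ) (P : Interaction Ω X H) : Prop where
  /-- `fhat t` is the least-squares estimate from the data of the rounds before `t`. -/
  fhat_spec : ∀ t ω, IsLeastSquares lam (P.x1 ω) (P.x2 ω) (P.feedback f ω) t (P.fhat t ω)
  /-- `xhat t` maximizes `fhat t`. -/
  xhat_spec : ∀ t ω x, P.fhat t ω x ≤ P.fhat t ω (P.xhat t ω)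
  p_mem : ∀ t ω, P.p t ω ∈ Set.Icc (0 : ℝ) 1
  /-- `(z t, p t)` minimizes the trade-off over `X × [0, 1]`. -/
  zp_spec : ∀ t ω, ∀ z : X, ∀ p ∈ Set.Icc (0 : ℝ) 1,
    idsObjective lam rho B delta (P.x1 ω) (P.x2 ω) t (P.fhat t ω) (P.xhat t ω)
        (P.z t ω) (P.p t ω) ≤
      idsObjective lam rho B delta (P.x1 ω) (P.x2 ω) t (P.fhat t ω) (P.xhat t ω) z p
  xhat_meas : ∀ t, Measurable[ℱ t, ⊤] (P.xhat t)
  z_meas : ∀ t, Measurable[ℱ t, ⊤] (P.z t)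
  p_meas : ∀ t, Measurable[ℱ t] (P.p t)
  b_meas : ∀ t, Measurable[ℱ (t + 1)] (P.b t)
  noise_meas : ∀ t, Measurable[ℱ (t + 1)] (P.noise t)
  /-- Given the past, `b t` is Bernoulli with parameter `p t`. -/
  b_law : ∀ t, μ[fun ω => if P.b t ω then (1 : ℝ) else 0 | ℱ t] =ᵐ[μ] P.p t

/-- Conditionally on `m`, the variable `Y` is (centred and) sub-Gaussian with variance proxy `v`. -/
def CondSubGaussian [MeasurableSpace Ω] (μ : Measure Ω) (m : MeasurableSpace Ω) (Y : Ω → ℝ)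
    (v : ℝ) : Prop :=
  ∀ η : ℝ, Integrable (fun ω => Real.exp (η * Y ω)) μ ∧
    μ[fun ω => Real.exp (η * Y ω) | m] ≤ᵐ[μ] fun _ => Real.exp (η ^ 2 * v / 2)

/-- The noise of each round is `ρ²`-sub-Gaussian given the past and the pair that is played (both
actions of round `t` are measurable for the σ-algebra below).  Otherwise its law is arbitrary. -/
def HasSubGaussianNoise [mΩ : MeasurableSpace Ω] (μ : Measure Ω) (ℱ : Filtration ℕ mΩ) (rho : ℝ)
    (P : Interaction Ω X H) : Prop :=
  ∀ t, CondSubGaussian μ (ℱ t ⊔ MeasurableSpace.comap (P.b t) ⊤) (P.noise t) (rho ^ 2)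

/-- The suboptimality gap of `x`, where `xstar` is the maximizer of `f`. -/
def gap (f : H) (xstar x : X) : ℝ := f xstar - f x

/-- The dueling regret of the rounds `0, …, n - 1`. -/
def duelRegret (f : H) (xstar : X) (P : Interaction Ω X H) (n : ℕ) (ω : Ω) : ℝ :=
  ∑ t ∈ Finset.range n, (gap f xstar (P.x1 ω t) + gap f xstar (P.x2 ω t))

end Run

end DuelingIDS

end

/-! Regression is moved into the Hilbert space. With φ_s the representer of the difference of
evaluations at the pair of round s, and R_t the inverse of λ + ∑_{s<t} φ_s ⊗ φ_s, the uncertainty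
ψ_t is λ times the quadratic form of R_t (`psi_eq`), and log det(I + λ⁻¹K_t) is ∑_{s<t} log(1 +
⟪φ_s, R_s φ_s⟫) (`log_det_eq`). The estimation error splits into a bias, bounded by √λ B, and the
self-normalized noise ⟪S_t, R_t S_t⟫ with S_t = ∑ ξ_s φ_s, which is controlled by a Gaussian mixture
supermartingale and Ville's inequality.

On a path where the estimates are accurate, optimality of (z_t, p_t) is tested against two
competitors (`tradeoff_le`). Both use a maximizer z' in the definition of δ_t: one takes p = 1, the
other, when δ_t is small, takes p equal to δ_t over the estimated gap of z'. With D the minimal gap,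
this bounds D times the regret of a round by a multiple of β I_t if there is feedback, and of β p_t
I_t if there is none (`round_regret_le`). The feedback terms sum to γ_n. The sum of the p_t I_t is
compared with γ_n by a multiplicative Bernoulli bound (`measure_bernoulli_le`), at the price of
log(n/δ).

The difficulty is the probability budget: the confidence bound with coefficient β_{t,δ} already
spends all of δ, and nothing seems left for the Bernoulli variables. The remedy is to tolerate an
extra error D/4, which the analysis of a round absorbs. Moreover, inaccuracy matters only where the
regret bound fails. Since the regret is at most 4nB, failure forces the noise part of the
coefficient to be at most n²D² (`coefficient_le_of_regret_gt`), so D is not small relative to it.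
The joint event then has probability at most δ - (δ/n)^40 (`measure_deviation_add_le`), and the
Bernoulli bound is run at level (δ/n)^40. -/

noncomputable section

namespace DuelingIDS

/-! ### Regularized covariance operators and their inverses. -/

section Resolvent

open scoped InnerProductSpace

variable {E : Type*} [NormedAddCommGroup E] [InnerProductSpace ℝ E]

/-- The regularized covariance operator `c + ∑_{s<t} φ_s ⊗ φ_s`. -/
def covOp (c : ℝ) (φ : ℕ → E) (t : ℕ) : E →ₗ[ℝ] E :=
  c • LinearMap.id + ∑ s ∈ Finset.range t, (innerₛₗ ℝ (φ s)).smulRight (φ s)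

/-- The inverse of `covOp`, by rank-one updates. -/
def resolvent (c : ℝ) (φ : ℕ → E) : ℕ → E →ₗ[ℝ] E
  | 0 => c⁻¹ • LinearMap.id
  | t + 1 => resolvent c φ t -
      (1 + ⟪φ t, resolvent c φ t (φ t)⟫_ℝ)⁻¹ •
        ((innerₛₗ ℝ (φ t)).comp (resolvent c φ t)).smulRight (resolvent c φ t (φ t))

lemma covOp_apply (c : ℝ) (φ : ℕ → E) (t : ℕ) (u : E) :
    covOp c φ t u = c • u + ∑ s ∈ Finset.range t, ⟪φ s, u⟫_ℝ • φ s := by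
  simp [covOp, LinearMap.sum_apply]

lemma covOp_succ (c : ℝ) (φ : ℕ → E) (t : ℕ) (u : E) :
    covOp c φ (t + 1) u = covOp c φ t u + ⟪φ t, u⟫_ℝ • φ t := by
  simp [covOp_apply, Finset.sum_range_succ, add_assoc]

lemma resolvent_zero (c : ℝ) (φ : ℕ → E) (u : E) : resolvent c φ 0 u = c⁻¹ • u := rfl

lemma resolvent_succ (c : ℝ) (φ : ℕ → E) (t : ℕ) (u : E) :
    resolvent c φ (t + 1) u = resolvent c φ t u -
      ((1 + ⟪φ t, resolvent c φ t (φ t)⟫_ℝ)⁻¹ * ⟪φ t, resolvent c φ t u⟫_ℝ) •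
        resolvent c φ t (φ t) := by
  simp [resolvent, smul_smul]

lemma covOp_symm (c : ℝ) (φ : ℕ → E) (t : ℕ) (u v : E) :
    ⟪covOp c φ t u, v⟫_ℝ = ⟪u, covOp c φ t v⟫_ℝ := by
  simp only [covOp_apply, inner_add_left, inner_add_right, inner_smul_left, inner_smul_right,
    sum_inner, inner_sum]
  simp only [conj_trivial]
  congr 1
  refine Finset.sum_congr rfl fun s _ => ?_
  rw [real_inner_comm u (φ s)]
  ring

lemma inner_covOp_self (c : ℝ) (φ : ℕ → E) (t : ℕ) (u : E) :
    ⟪u, covOp c φ t u⟫_ℝ = c * ‖u‖ ^ 2 + ∑ s ∈ Finset.range t, ⟪φ s, u⟫_ℝ ^ 2 := by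
  simp only [covOp_apply, inner_add_right, inner_smul_right, inner_sum,
    real_inner_self_eq_norm_sq]
  congr 1
  refine Finset.sum_congr rfl fun s _ => ?_
  rw [real_inner_comm u (φ s)]
  ring

lemma le_inner_covOp_self (c : ℝ) (φ : ℕ → E) (t : ℕ) (u : E) :
    c * ‖u‖ ^ 2 ≤ ⟪u, covOp c φ t u⟫_ℝ := by
  rw [inner_covOp_self]
  exact le_add_of_nonneg_right (Finset.sum_nonneg fun s _ => sq_nonneg _)

lemma inner_covOp_self_le (c : ℝ) (φ : ℕ → E) (t : ℕ) (u : E) :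
    ⟪u, covOp c φ t u⟫_ℝ ≤ (c + ∑ s ∈ Finset.range t, ‖φ s‖ ^ 2) * ‖u‖ ^ 2 := by
  rw [inner_covOp_self, add_mul, Finset.sum_mul]
  gcongr with s _
  rw [← mul_pow, ← sq_abs]
  gcongr
  exact abs_real_inner_le_norm _ _

variable {c : ℝ} (hc : 0 < c) (φ : ℕ → E) (t : ℕ)
include hc

/-- This is the Sherman–Morrison formula. The induction hypothesis itself supplies ⟪φ_t, R_t φ_t⟫ ≥
0, so the denominator of the update does not vanish. -/
lemma covOp_resolvent (u : E) : covOp c φ t (resolvent c φ t u) = u := by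
  induction t generalizing u with
  | zero => simp [covOp_apply, resolvent_zero, smul_smul, hc.ne']
  | succ t ih =>
    have hw : 0 ≤ ⟪φ t, resolvent c φ t (φ t)⟫_ℝ := by
      have h := le_inner_covOp_self c φ t (resolvent c φ t (φ t))
      rw [ih, real_inner_comm] at h
      exact le_trans (by positivity) h
    rw [covOp_succ, resolvent_succ, map_sub, map_smul, ih, ih, inner_sub_right,
      inner_smul_right]
    set w := ⟪φ t, resolvent c φ t (φ t)⟫_ℝ
    set a := ⟪φ t, resolvent c φ t u⟫_ℝ
    have h1 : a - (1 + w)⁻¹ * a * w = (1 + w)⁻¹ * a := by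
      field_simp
      ring
    rw [h1]
    abel

lemma covOp_injective : Function.Injective (covOp c φ t) := by
  rw [injective_iff_map_eq_zero]
  intro u hu
  have h := le_inner_covOp_self c φ t u
  rw [hu, inner_zero_right] at h
  have : ‖u‖ ^ 2 = 0 := le_antisymm (by
    by_contra hcon
    push Not at hcon
    have := mul_pos hc hcon
    linarith) (sq_nonneg _)
  simpa using this

lemma resolvent_covOp (u : E) : resolvent c φ t (covOp c φ t u) = u :=
  covOp_injective hc φ t (covOp_resolvent hc φ t _)

lemma resolvent_symm (u v : E) :
    ⟪resolvent c φ t u, v⟫_ℝ = ⟪u, resolvent c φ t v⟫_ℝ := by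
  conv_lhs => rw [← covOp_resolvent hc φ t v]
  rw [← covOp_symm, covOp_resolvent hc]

lemma inner_resolvent_comm (u v : E) :
    ⟪u, resolvent c φ t v⟫_ℝ = ⟪v, resolvent c φ t u⟫_ℝ := by
  rw [← resolvent_symm hc, real_inner_comm]

lemma le_inner_resolvent_self (u : E) :
    c * ‖resolvent c φ t u‖ ^ 2 ≤ ⟪u, resolvent c φ t u⟫_ℝ := by
  have h := le_inner_covOp_self c φ t (resolvent c φ t u)
  rwa [covOp_resolvent hc, real_inner_comm] at h

lemma inner_resolvent_self_nonneg (u : E) : 0 ≤ ⟪u, resolvent c φ t u⟫_ℝ :=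
  le_trans (by positivity) (le_inner_resolvent_self hc φ t u)

lemma inner_resolvent_self_le (u : E) : ⟪u, resolvent c φ t u⟫_ℝ ≤ ‖u‖ ^ 2 / c := by
  have h1 := le_inner_resolvent_self hc φ t u
  have h2 := real_inner_le_norm u (resolvent c φ t u)
  have h3 : c * ‖resolvent c φ t u‖ ≤ ‖u‖ := by
    rcases (norm_nonneg (resolvent c φ t u)).eq_or_lt with h | h
    · rw [← h]; simp
    · nlinarith
  rw [le_div_iff₀ hc]
  nlinarith [norm_nonneg u]

/-- The Cauchy-Schwarz inequality for the inner product `⟪·, R_t ·⟫`. -/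
lemma inner_resolvent_sq_le (u v : E) :
    ⟪u, resolvent c φ t v⟫_ℝ ^ 2 ≤
      ⟪u, resolvent c φ t u⟫_ℝ * ⟪v, resolvent c φ t v⟫_ℝ := by
  have h := LinearMap.BilinForm.apply_mul_apply_le_of_forall_zero_le
    ((innerₗ E).compl₂ (resolvent c φ t)) (fun x => by
      simpa using inner_resolvent_self_nonneg hc φ t x) u v
  simp only [LinearMap.compl₂_apply, innerₗ_apply_apply] at h
  rwa [inner_resolvent_comm hc φ t v u, ← sq] at h

lemma abs_inner_resolvent_le (u v : E) :
    |⟪u, resolvent c φ t v⟫_ℝ| ≤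
      √⟪u, resolvent c φ t u⟫_ℝ * √⟪v, resolvent c φ t v⟫_ℝ := by
  rw [← Real.sqrt_mul (inner_resolvent_self_nonneg hc φ t u)]
  exact Real.abs_le_sqrt (inner_resolvent_sq_le hc φ t u v)

/-- Cauchy–Schwarz for the form of R_t, applied to u and its image under the covariance operator,
reduces the claim to the trace bound c + ∑ ‖φ_s‖² on that operator. -/
lemma norm_sq_div_le_inner_resolvent_self (u : E) :
    ‖u‖ ^ 2 / (c + ∑ s ∈ Finset.range t, ‖φ s‖ ^ 2) ≤ ⟪u, resolvent c φ t u⟫_ℝ := by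
  have hτ : 0 ≤ ∑ s ∈ Finset.range t, ‖φ s‖ ^ 2 := Finset.sum_nonneg fun s _ => by positivity
  set τ := ∑ s ∈ Finset.range t, ‖φ s‖ ^ 2
  have h := inner_resolvent_sq_le hc φ t u (covOp c φ t u)
  rw [resolvent_covOp hc, real_inner_self_eq_norm_sq,
    real_inner_comm u (covOp c φ t u)] at h
  have h2 := inner_covOp_self_le c φ t u
  have h3 := inner_resolvent_self_nonneg hc φ t u
  rw [div_le_iff₀ (by positivity)]
  rcases (sq_nonneg ‖u‖).eq_or_lt with h0 | h0
  · rw [← h0]; positivity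
  · have h4 : (‖u‖ ^ 2) ^ 2 ≤ (⟪u, resolvent c φ t u⟫_ℝ * (c + τ)) * ‖u‖ ^ 2 := by
      refine h.trans ?_
      rw [mul_assoc]
      exact mul_le_mul_of_nonneg_left h2 h3
    nlinarith

/-- The rank-one update of the quadratic form `⟪S, R_t S⟫` when `S` moves along `φ t`. -/
lemma inner_resolvent_succ_update (S : E) (x : ℝ) :
    ⟪S + x • φ t, resolvent c φ (t + 1) (S + x • φ t)⟫_ℝ =
      ⟪S, resolvent c φ t S⟫_ℝ +
        (2 * x * ⟪φ t, resolvent c φ t S⟫_ℝ + x ^ 2 * ⟪φ t, resolvent c φ t (φ t)⟫_ℝ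
          - ⟪φ t, resolvent c φ t S⟫_ℝ ^ 2) / (1 + ⟪φ t, resolvent c φ t (φ t)⟫_ℝ) := by
  have hw := inner_resolvent_self_nonneg hc φ t (φ t)
  rw [resolvent_succ, map_add, map_smul]
  simp only [inner_add_left, inner_add_right, inner_sub_right, inner_smul_left, inner_smul_right,
    conj_trivial]
  rw [inner_resolvent_comm hc φ t S (φ t)]
  field_simp
  ring

end Resolvent

/-! ### Kernel quantities as inner products of features. -/

section Features

open scoped InnerProductSpace

variable {X : Type*} {H : Type*} [NormedAddCommGroup H] [InnerProductSpace ℝ H] [CompleteSpace H]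
  [RKHS ℝ H X ℝ]

variable (H) in
/-- The representer of the evaluation at `x`. -/
def feature (x : X) : H := RKHS.kerFun H x 1

lemma inner_feature (h : H) (x : X) : ⟪h, feature H x⟫_ℝ = h x := by
  simp [feature]

lemma feature_inner (h : H) (x : X) : ⟪feature H x, h⟫_ℝ = h x := by
  rw [real_inner_comm, inner_feature]

lemma kern_eq (x y : X) : kern H x y = ⟪feature H x, feature H y⟫_ℝ := by
  rw [feature_inner, feature, RKHS.kerFun_apply, kern]

variable (H) in
/-- The representer of `h ↦ h (x1 s) - h (x2 s)`. -/
def pairFeature (x1 x2 : ℕ → X) (s : ℕ) : H := feature H (x1 s) - feature H (x2 s)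

lemma pairFeature_inner (x1 x2 : ℕ → X) (s : ℕ) (h : H) :
    ⟪pairFeature H x1 x2 s, h⟫_ℝ = h (x1 s) - h (x2 s) := by
  rw [pairFeature, inner_sub_left, feature_inner, feature_inner]

lemma gram_apply (x1 x2 : ℕ → X) (t : ℕ) (i j : Fin t) :
    gram H x1 x2 t i j = ⟪pairFeature H x1 x2 i, pairFeature H x1 x2 j⟫_ℝ := by
  simp only [gram, Matrix.of_apply, kern_eq, pairFeature, inner_sub_left, inner_sub_right]
  ring

lemma gram_eq (x1 x2 : ℕ → X) (t : ℕ) :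
    gram H x1 x2 t = Matrix.gram ℝ fun i : Fin t => pairFeature H x1 x2 i := by
  ext i j
  rw [gram_apply, Matrix.gram_apply]

lemma kvec_apply (x1 x2 : ℕ → X) (t : ℕ) (x : X) (i : Fin t) :
    kvec H x1 x2 t x i = ⟪pairFeature H x1 x2 i, feature H x⟫_ℝ := by
  rw [real_inner_comm, pairFeature, inner_sub_right, kvec, kern_eq, kern_eq]

lemma gram_add_posDef (x1 x2 : ℕ → X) (t : ℕ) {lam : ℝ} (hlam : 0 < lam) :
    (gram H x1 x2 t + lam • (1 : Matrix (Fin t) (Fin t) ℝ)).PosDef := by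
  rw [gram_eq]
  exact Matrix.PosDef.posSemidef_add (Matrix.posSemidef_gram ℝ _)
    (Matrix.PosDef.one.smul hlam)

/-- The push-through identity, which links the t × t matrix inverse to the inverse operator on `H`.
Both sides agree after applying the injective covariance operator. -/
lemma resolvent_feature (x1 x2 : ℕ → X) (t : ℕ) {lam : ℝ} (hlam : 0 < lam) (y : X) :
    lam • resolvent lam (pairFeature H x1 x2) t (feature H y) = feature H y -
      ∑ i : Fin t, ((gram H x1 x2 t + lam • (1 : Matrix (Fin t) (Fin t) ℝ))⁻¹ *ᵥ
        kvec H x1 x2 t y) i • pairFeature H x1 x2 i := by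
  set A := gram H x1 x2 t + lam • (1 : Matrix (Fin t) (Fin t) ℝ) with hA
  set c := A⁻¹ *ᵥ kvec H x1 x2 t y with hc
  have hdet : IsUnit A.det := (gram_add_posDef x1 x2 t hlam).det_pos.ne'.isUnit
  have hAc : A *ᵥ c = kvec H x1 x2 t y := by
    rw [hc, Matrix.mulVec_mulVec, Matrix.mul_nonsing_inv _ hdet, Matrix.one_mulVec]
  apply covOp_injective hlam (pairFeature H x1 x2) t
  rw [map_smul, covOp_resolvent hlam, covOp_apply, Finset.sum_range, smul_sub]
  have h : ∀ s : Fin t, ⟪pairFeature H x1 x2 s, feature H y - ∑ i : Fin t,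
      c i • pairFeature H x1 x2 i⟫_ℝ = lam * c s := by
    intro s
    have h1 := congrFun hAc s
    rw [hA, Matrix.add_mulVec, Matrix.smul_mulVec, Matrix.one_mulVec, Pi.add_apply,
      Pi.smul_apply, kvec_apply, Matrix.mulVec, dotProduct, smul_eq_mul] at h1
    rw [inner_sub_right, ← h1, inner_sum]
    simp only [inner_smul_right, gram_apply]
    rw [Finset.sum_congr rfl fun i _ => mul_comm (c i) _]
    ring
  simp only [h, mul_smul, ← Finset.smul_sum]
  abel

lemma postKern_eq (x1 x2 : ℕ → X) (t : ℕ) {lam : ℝ} (hlam : 0 < lam) (x y : X) :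
    postKern H lam x1 x2 t x y =
      lam * ⟪feature H x, resolvent lam (pairFeature H x1 x2) t (feature H y)⟫_ℝ := by
  rw [← inner_smul_right, resolvent_feature x1 x2 t hlam, inner_sub_right, inner_sum, postKern,
    kern_eq, dotProduct]
  congr 1
  refine Finset.sum_congr rfl fun i _ => ?_
  rw [inner_smul_right, kvec_apply, real_inner_comm, mul_comm]

lemma psi_eq (x1 x2 : ℕ → X) (t : ℕ) {lam : ℝ} (hlam : 0 < lam) (x z : X) :
    psi H lam x1 x2 t x z = lam * ⟪feature H x - feature H z,
      resolvent lam (pairFeature H x1 x2) t (feature H x - feature H z)⟫_ℝ := by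
  rw [psi, postKern_eq x1 x2 t hlam, postKern_eq x1 x2 t hlam, postKern_eq x1 x2 t hlam, map_sub,
    inner_sub_left, inner_sub_right, inner_sub_right,
    inner_resolvent_comm hlam _ t (feature H z) (feature H x)]
  ring

lemma psi_self (lam : ℝ) (x1 x2 : ℕ → X) (t : ℕ) (x : X) : psi H lam x1 x2 t x x = 0 := by
  rw [psi]; ring

lemma psi_nonneg (x1 x2 : ℕ → X) (t : ℕ) {lam : ℝ} (hlam : 0 < lam) (x z : X) :
    0 ≤ psi H lam x1 x2 t x z := by
  rw [psi_eq x1 x2 t hlam]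
  exact mul_nonneg hlam.le (inner_resolvent_self_nonneg hlam _ _ _)

lemma norm_feature_le (hk : ∀ x : X, kern H x x ≤ 1) (x : X) : ‖feature H x‖ ≤ 1 := by
  have h := hk x
  rw [kern_eq, real_inner_self_eq_norm_sq] at h
  nlinarith [norm_nonneg (feature H x)]

lemma norm_feature_sub_le (hk : ∀ x : X, kern H x x ≤ 1) (x z : X) :
    ‖feature H x - feature H z‖ ≤ 2 := by
  have := norm_sub_le (feature H x) (feature H z)
  have := norm_feature_le hk x
  have := norm_feature_le hk z
  linarith

lemma psi_le (hk : ∀ x : X, kern H x x ≤ 1) (x1 x2 : ℕ → X) (t : ℕ) {lam : ℝ} (hlam : 0 < lam)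
    (x z : X) : psi H lam x1 x2 t x z ≤ 4 := by
  rw [psi_eq x1 x2 t hlam]
  have h := inner_resolvent_self_le hlam (pairFeature H x1 x2) t (feature H x - feature H z)
  rw [le_div_iff₀ hlam] at h
  have := norm_feature_sub_le hk x z
  nlinarith [norm_nonneg (feature H x - feature H z)]

lemma sub_apply_le (hk : ∀ x : X, kern H x x ≤ 1) (f : H) (x z : X) :
    f x - f z ≤ 2 * ‖f‖ := by
  rw [← inner_feature f x, ← inner_feature f z, ← inner_sub_right]
  have h := real_inner_le_norm f (feature H x - feature H z)
  have := norm_feature_sub_le hk x z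
  nlinarith [norm_nonneg f]

lemma one_add_smul_gram_posDef (x1 x2 : ℕ → X) (t : ℕ) {lam : ℝ} (hlam : 0 < lam) :
    (1 + lam⁻¹ • gram H x1 x2 t).PosDef := by
  have h := (gram_add_posDef (H := H) x1 x2 t hlam).smul (inv_pos.2 hlam)
  rwa [smul_add, smul_smul, inv_mul_cancel₀ hlam.ne', one_smul, add_comm] at h

/-- The second factor is the Schur complement of the leading t × t block: the new diagonal entry
corrected by the posterior variance reduction. -/
lemma det_succ (x1 x2 : ℕ → X) (t : ℕ) {lam : ℝ} (hlam : 0 < lam) :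
    (1 + lam⁻¹ • gram H x1 x2 (t + 1)).det = (1 + lam⁻¹ • gram H x1 x2 t).det *
      (1 + lam⁻¹ * psi H lam x1 x2 t (x1 t) (x2 t)) := by
  set A := 1 + lam⁻¹ • gram H x1 x2 t with hA
  set G := gram H x1 x2 t + lam • (1 : Matrix (Fin t) (Fin t) ℝ) with hG
  have hAG : A = lam⁻¹ • G := by
    rw [hA, hG, smul_add, smul_smul, inv_mul_cancel₀ hlam.ne', one_smul, add_comm]
  have hGdet : IsUnit G.det := (gram_add_posDef x1 x2 t hlam).det_pos.ne'.isUnit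
  have hAdet : IsUnit A.det := (one_add_smul_gram_posDef x1 x2 t hlam).det_pos.ne'.isUnit
  let _ : Invertible A := Matrix.invertibleOfIsUnitDet A hAdet
  have hinv : ⅟A = lam • G⁻¹ := by
    rw [Matrix.invOf_eq_nonsing_inv]
    apply Matrix.inv_eq_right_inv
    rw [hAG, Matrix.smul_mul, Matrix.mul_smul, Matrix.mul_nonsing_inv _ hGdet, smul_smul,
      inv_mul_cancel₀ hlam.ne', one_smul]
  let v : Fin t → ℝ := fun i => ⟪pairFeature H x1 x2 i, pairFeature H x1 x2 t⟫_ℝ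
  have hblock : (1 + lam⁻¹ • gram H x1 x2 (t + 1)).submatrix finSumFinEquiv finSumFinEquiv =
      Matrix.fromBlocks A (Matrix.of fun i (_ : Fin 1) => lam⁻¹ * v i)
        (Matrix.of fun (_ : Fin 1) i => lam⁻¹ * v i)
        (Matrix.of fun (_ _ : Fin 1) => 1 + lam⁻¹ * ‖pairFeature H x1 x2 t‖ ^ 2) := by
    ext i j
    rcases i with i | i <;> rcases j with j | j
    · simp [hA, Matrix.one_apply, gram_apply, Fin.ext_iff]
    · simp [gram_apply, Fin.ext_iff, v, i.2.ne]
    · simp [gram_apply, Fin.ext_iff, v, j.2.ne', real_inner_comm]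
    · simp [Matrix.one_apply, gram_apply, Fin.ext_iff]
  rw [← Matrix.det_submatrix_equiv_self finSumFinEquiv, hblock, Matrix.det_fromBlocks₁₁]
  congr 1
  rw [Matrix.det_fin_one, hinv]
  have hv : v = kvec H x1 x2 t (x1 t) - kvec H x1 x2 t (x2 t) := by
    ext i
    rw [Pi.sub_apply, kvec_apply, kvec_apply, ← inner_sub_right, ← pairFeature]
  have hpsi : psi H lam x1 x2 t (x1 t) (x2 t) =
      ‖pairFeature H x1 x2 t‖ ^ 2 - v ⬝ᵥ (G⁻¹ *ᵥ v) := by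
    rw [psi_eq x1 x2 t hlam, ← inner_smul_right, map_sub, smul_sub,
      resolvent_feature x1 x2 t hlam, resolvent_feature x1 x2 t hlam, ← hG, hv, Matrix.mulVec_sub]
    rw [sub_sub_sub_comm, ← Finset.sum_sub_distrib, inner_sub_right, ← pairFeature,
      real_inner_self_eq_norm_sq, inner_sum]
    congr 1
    rw [← hv, dotProduct]
    refine Finset.sum_congr rfl fun i _ => ?_
    rw [← sub_smul, inner_smul_right, real_inner_comm, mul_comm, Pi.sub_apply]
  rw [hpsi]
  simp only [Matrix.sub_apply, Matrix.of_apply, Matrix.mul_apply, Matrix.smul_apply, smul_eq_mul,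
    dotProduct, Matrix.mulVec]
  have : ∑ j, (∑ i, lam⁻¹ * v i * (lam * G⁻¹ i j)) * (lam⁻¹ * v j) =
      lam⁻¹ * ∑ i, v i * ∑ j, G⁻¹ i j * v j := by
    simp only [Finset.sum_mul, Finset.mul_sum]
    rw [Finset.sum_comm]
    refine Finset.sum_congr rfl fun i _ => Finset.sum_congr rfl fun j _ => ?_
    field_simp
  rw [this]
  ring

lemma psi_pair_eq (x1 x2 : ℕ → X) (t : ℕ) {lam : ℝ} (hlam : 0 < lam) :
    lam⁻¹ * psi H lam x1 x2 t (x1 t) (x2 t) = ⟪pairFeature H x1 x2 t,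
      resolvent lam (pairFeature H x1 x2) t (pairFeature H x1 x2 t)⟫_ℝ := by
  rw [psi_eq x1 x2 t hlam, ← pairFeature, inv_mul_cancel_left₀ hlam.ne']

end Features

/-! ### Bounds on the log-determinant. -/

section LogDet
open scoped InnerProductSpace

variable {E : Type*} [NormedAddCommGroup E] [InnerProductSpace ℝ E]

/-- The log-determinant `∑_{s<t} log (1 + ⟪φ_s, R_s φ_s⟫)`. -/
def logVolume (c : ℝ) (φ : ℕ → E) (t : ℕ) : ℝ :=
  ∑ s ∈ Finset.range t, Real.log (1 + ⟪φ s, resolvent c φ s (φ s)⟫_ℝ)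

variable {c : ℝ} (hc : 0 < c) (φ : ℕ → E)
include hc

lemma logVolume_mono : Monotone (logVolume c φ) := by
  refine monotone_nat_of_le_succ fun t => ?_
  rw [logVolume, logVolume, Finset.sum_range_succ]
  have := inner_resolvent_self_nonneg hc φ t (φ t)
  exact le_add_of_nonneg_right (Real.log_nonneg (by linarith))

lemma logVolume_nonneg (t : ℕ) : 0 ≤ logVolume c φ t := by
  simpa [logVolume] using logVolume_mono hc φ (Nat.zero_le t)

lemma logVolume_le (t : ℕ) :
    logVolume c φ t ≤ (∑ s ∈ Finset.range t, ‖φ s‖ ^ 2) / c := by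
  rw [logVolume, Finset.sum_div]
  refine Finset.sum_le_sum fun s _ => ?_
  have h0 := inner_resolvent_self_nonneg hc φ s (φ s)
  have h1 := inner_resolvent_self_le hc φ s (φ s)
  have h2 := Real.log_le_sub_one_of_pos (show 0 < 1 + ⟪φ s, resolvent c φ s (φ s)⟫_ℝ by linarith)
  linarith

/-- Each summand satisfies log(1 + w) ≥ w/(1 + w), and w is at least ‖φ_s‖² over c plus the earlier
squared norms. Together with `logVolume_le`, this compares log-determinants for different
regularizers through ∑ ‖φ_s‖² alone. -/
lemma le_logVolume (t : ℕ) : (∑ s ∈ Finset.range t, ‖φ s‖ ^ 2) /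
    (c + ∑ s ∈ Finset.range t, ‖φ s‖ ^ 2) ≤ logVolume c φ t := by
  rw [logVolume, Finset.sum_div]
  refine Finset.sum_le_sum fun s hs => ?_
  have h0 := inner_resolvent_self_nonneg hc φ s (φ s)
  have h1 := norm_sq_div_le_inner_resolvent_self hc φ s (φ s)
  have hpos : 0 < c + ∑ r ∈ Finset.range s, ‖φ r‖ ^ 2 := by positivity
  set w := ⟪φ s, resolvent c φ s (φ s)⟫_ℝ
  have hle : c + ∑ r ∈ Finset.range s, ‖φ r‖ ^ 2 + ‖φ s‖ ^ 2 ≤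
      c + ∑ r ∈ Finset.range t, ‖φ r‖ ^ 2 := by
    rw [add_assoc, ← Finset.sum_range_succ]
    gcongr
    exact Finset.mem_range.1 hs
  have h2 := Real.one_sub_inv_le_log_of_pos (show 0 < 1 + w by linarith)
  refine le_trans ?_ h2
  have h3 : 1 - (1 + w)⁻¹ = w / (1 + w) := by field_simp; ring
  rw [h3]
  rw [div_le_iff₀ hpos] at h1
  calc ‖φ s‖ ^ 2 / (c + ∑ r ∈ Finset.range t, ‖φ r‖ ^ 2)
      ≤ ‖φ s‖ ^ 2 / (c + ∑ r ∈ Finset.range s, ‖φ r‖ ^ 2 + ‖φ s‖ ^ 2) := by gcongr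
    _ ≤ w / (1 + w) := by
      rw [div_le_div_iff₀ (by positivity) (by positivity)]
      nlinarith

end LogDet

/-! ### Normal equation and error decomposition of kernel least squares. -/

section Regression
open scoped InnerProductSpace

variable {X : Type*} {H : Type*} [NormedAddCommGroup H] [InnerProductSpace ℝ H] [CompleteSpace H]
  [RKHS ℝ H X ℝ]

lemma log_det_eq (x1 x2 : ℕ → X) (t : ℕ) {lam : ℝ} (hlam : 0 < lam) :
    Real.log (1 + lam⁻¹ • gram H x1 x2 t).det = logVolume lam (pairFeature H x1 x2) t := by
  induction t with
  | zero => simp [logVolume]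
  | succ t ih =>
    have h := inner_resolvent_self_nonneg hlam (pairFeature H x1 x2) t (pairFeature H x1 x2 t)
    rw [det_succ x1 x2 t hlam, psi_pair_eq x1 x2 t hlam, Real.log_mul
      (one_add_smul_gram_posDef x1 x2 t hlam).det_pos.ne' (by positivity), ih, logVolume,
      logVolume, Finset.sum_range_succ]

/-- The normal equation of kernel least squares. -/
lemma IsLeastSquares.covOp_eq {lam : ℝ} {x1 x2 : ℕ → X} {d : ℕ → ℝ} {t : ℕ} {g : H}
    (hg : IsLeastSquares lam x1 x2 d t g) :
    covOp lam (pairFeature H x1 x2) t g =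
      ∑ s ∈ Finset.range t, d s • pairFeature H x1 x2 s := by
  refine ext_inner_right ℝ fun h => ?_
  have hpoly : ∀ ε : ℝ, 0 ≤ 2 * ε * ⟪covOp lam (pairFeature H x1 x2) t g -
      ∑ s ∈ Finset.range t, d s • pairFeature H x1 x2 s, h⟫_ℝ +
      ε ^ 2 * ⟪h, covOp lam (pairFeature H x1 x2) t h⟫_ℝ := by
    intro ε
    have h1 := hg (Set.mem_univ (g + ε • h))
    rw [Set.mem_ofPred_eq] at h1
    beta_reduce at h1
    rw [← sub_nonneg] at h1
    refine h1.trans_eq ?_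
    rw [inner_covOp_self, covOp_apply, inner_sub_left, inner_add_left, sum_inner, sum_inner,
      inner_smul_left, norm_add_sq_real, inner_smul_right, norm_smul, mul_pow, Real.norm_eq_abs,
      sq_abs]
    have h2 : ∀ s, (((g + ε • h : H) (x1 s) - (g + ε • h : H) (x2 s) - d s) ^ 2) =
        (g (x1 s) - g (x2 s) - d s) ^ 2 +
          (2 * ε * (⟪⟪pairFeature H x1 x2 s, g⟫_ℝ • pairFeature H x1 x2 s, h⟫_ℝ -
            ⟪d s • pairFeature H x1 x2 s, h⟫_ℝ) + ε ^ 2 * ⟪pairFeature H x1 x2 s, h⟫_ℝ ^ 2) := by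
      intro s
      simp only [inner_smul_left, pairFeature_inner, RKHS.coe_add, RKHS.coe_smul, Pi.add_apply,
        Pi.smul_apply, smul_eq_mul, conj_trivial]
      ring
    simp only [h2, Finset.sum_add_distrib, ← Finset.mul_sum, Finset.sum_sub_distrib]
    simp only [conj_trivial]
    ring
  -- A quadratic 2εa + ε²q that is nonnegative for all ε has a = 0. The value ε = -a/(1 + |q|) shows
  -- this without assuming a sign for q.
  set a := ⟪covOp lam (pairFeature H x1 x2) t g -
      ∑ s ∈ Finset.range t, d s • pairFeature H x1 x2 s, h⟫_ℝ with ha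
  set q := ⟪h, covOp lam (pairFeature H x1 x2) t h⟫_ℝ
  have ha0 : a = 0 := by
    have h1 := hpoly (-a / (1 + |q|))
    have hq : 0 < 1 + |q| := by positivity
    have h2 : 2 * (-a / (1 + |q|)) * a + (-a / (1 + |q|)) ^ 2 * q =
        (a ^ 2 / (1 + |q|) ^ 2) * (q - 2 * (1 + |q|)) := by
      field_simp
      ring
    rw [h2] at h1
    by_contra hne
    have h3 : 0 < a ^ 2 / (1 + |q|) ^ 2 := by positivity
    have h4 : q - 2 * (1 + |q|) < 0 := by linarith [le_abs_self q, abs_nonneg q]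
    nlinarith
  rwa [ha, inner_sub_left, sub_eq_zero] at ha0

/-- The confidence bound of kernel least squares in terms of the aggregated noise. -/
lemma IsLeastSquares.abs_error_le {lam B : ℝ} (hlam : 0 < lam) {x1 x2 : ℕ → X} {d ξ : ℕ → ℝ}
    {t : ℕ} {f g : H} (hf : ‖f‖ ≤ B) (hg : IsLeastSquares lam x1 x2 d t g)
    (hd : ∀ s < t, d s • pairFeature H x1 x2 s =
      (f (x1 s) - f (x2 s) + ξ s) • pairFeature H x1 x2 s) (x z : X) :
    |(g x - f x) - (g z - f z)| ≤
      (√⟪∑ s ∈ Finset.range t, ξ s • pairFeature H x1 x2 s,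
        resolvent lam (pairFeature H x1 x2) t
          (∑ s ∈ Finset.range t, ξ s • pairFeature H x1 x2 s)⟫_ℝ + √lam * B) *
      √(psi H lam x1 x2 t x z / lam) := by
  set φ := pairFeature H x1 x2 with hφ
  set S := ∑ s ∈ Finset.range t, ξ s • φ s with hS
  set u := feature H x - feature H z with hu
  -- Noise enters through S, regularization bias through λf; applying R_t separates the two
  -- contributions.
  have h1 : covOp lam φ t (g - f) = S - lam • f := by
    rw [map_sub, hg.covOp_eq, covOp_apply, ← hφ,
      Finset.sum_congr rfl fun s hs => hd s (Finset.mem_range.1 hs)]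
    simp only [add_smul, Finset.sum_add_distrib, ← pairFeature_inner x1 x2, ← hφ]
    abel
  have h2 : (g x - f x) - (g z - f z) =
      ⟪u, resolvent lam φ t S⟫_ℝ - lam * ⟪u, resolvent lam φ t f⟫_ℝ := by
    rw [← inner_smul_right, ← inner_sub_right, ← map_smul, ← map_sub, ← h1,
      resolvent_covOp hlam, hu, inner_sub_left, feature_inner, feature_inner]
    simp
  have hpsi : psi H lam x1 x2 t x z / lam = ⟪u, resolvent lam φ t u⟫_ℝ := by
    rw [psi_eq x1 x2 t hlam, mul_div_cancel_left₀ _ hlam.ne']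
  rw [h2, hpsi, add_mul]
  refine (abs_sub _ _).trans (add_le_add ?_ ?_)
  · rw [mul_comm]
    exact abs_inner_resolvent_le hlam φ t u S
  · rw [abs_mul, abs_of_pos hlam]
    have h3 := abs_inner_resolvent_le hlam φ t u f
    have h4 : √⟪f, resolvent lam φ t f⟫_ℝ ≤ B / √lam := by
      rw [← Real.sqrt_sq (le_trans (norm_nonneg f) hf), ← Real.sqrt_div (sq_nonneg _)]
      apply Real.sqrt_le_sqrt
      refine (inner_resolvent_self_le hlam φ t f).trans ?_
      gcongr
    have hsq : 0 < √lam := Real.sqrt_pos.2 hlam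
    calc lam * |⟪u, resolvent lam φ t f⟫_ℝ|
        ≤ lam * (√⟪u, resolvent lam φ t u⟫_ℝ * (B / √lam)) := by gcongr; exact h3.trans (by gcongr)
      _ = √lam * B * √⟪u, resolvent lam φ t u⟫_ℝ := by
        nth_rewrite 1 [← Real.mul_self_sqrt hlam.le]
        field_simp

end Regression

/-! ### Exponential moments with predictable coefficients, and Gaussian mixing. -/

section SubGaussian

variable {Ω : Type*} {m mΩ : MeasurableSpace Ω} {μ : Measure Ω} [IsFiniteMeasure μ]
  {ζ : Ω → ℝ} {v : ℝ}

lemma CondSubGaussian.setLIntegral_exp_le (h : CondSubGaussian μ m ζ v) (hm : m ≤ mΩ) (η : ℝ)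
    {A : Set Ω} (hA : MeasurableSet[m] A) :
    ∫⁻ ω in A, ENNReal.ofReal (Real.exp (η * ζ ω - η ^ 2 * v / 2)) ∂μ ≤ μ A := by
  obtain ⟨hint, hle⟩ := h η
  have h1 : ∫ ω in A, Real.exp (η * ζ ω) ∂μ ≤ Real.exp (η ^ 2 * v / 2) * μ.real A := by
    rw [← setIntegral_condExp hm hint hA]
    refine (setIntegral_mono_ae integrable_condExp.integrableOn
      (integrable_const _).integrableOn hle).trans_eq ?_
    rw [setIntegral_const, smul_eq_mul, mul_comm]
  have h2 : ∀ ω, Real.exp (η * ζ ω - η ^ 2 * v / 2) =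
      Real.exp (-(η ^ 2 * v / 2)) * Real.exp (η * ζ ω) := by
    intro ω; rw [← Real.exp_add]; congr 1; ring
  simp only [h2]
  rw [← ofReal_integral_eq_lintegral_ofReal (hint.integrableOn.const_mul _)
    (Filter.Eventually.of_forall fun ω => by positivity), integral_const_mul]
  refine (ENNReal.ofReal_le_ofReal (mul_le_mul_of_nonneg_left h1 (Real.exp_pos _).le)).trans_eq ?_
  rw [← mul_assoc, ← Real.exp_add, neg_add_cancel, Real.exp_zero, one_mul, ofReal_measureReal]

/-- The hypothesis concerns a fixed η. A finitely valued η is handled fibre by fibre; general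
measurable η then follow by simple approximation and Fatou's lemma. -/
lemma CondSubGaussian.setLIntegral_exp_finite_le (h : CondSubGaussian μ m ζ v) (hm : m ≤ mΩ)
    (hζ : Measurable ζ) {y : Ω → ℝ} (hy : Measurable[m] y) (hfin : (Set.range y).Finite)
    {A : Set Ω} (hA : MeasurableSet[m] A) :
    ∫⁻ ω in A, ENNReal.ofReal (Real.exp (y ω * ζ ω - y ω ^ 2 * v / 2)) ∂μ ≤ μ A := by
  have hfib : ∀ η, MeasurableSet[m] (y ⁻¹' {η}) := fun η => hy (measurableSet_singleton η)
  have h1 : ∀ ω, ENNReal.ofReal (Real.exp (y ω * ζ ω - y ω ^ 2 * v / 2)) =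
      ∑ η ∈ hfin.toFinset, (y ⁻¹' {η}).indicator
        (fun ω => ENNReal.ofReal (Real.exp (η * ζ ω - η ^ 2 * v / 2))) ω := by
    intro ω
    rw [Finset.sum_eq_single (y ω)]
    · simp
    · intro η _ hne
      simp [Set.indicator_of_notMem, hne.symm]
    · intro hn
      simp at hn
  simp only [h1]
  rw [lintegral_finsetSum]
  · calc _ = ∑ η ∈ hfin.toFinset, ∫⁻ ω in A ∩ y ⁻¹' {η},
          ENNReal.ofReal (Real.exp (η * ζ ω - η ^ 2 * v / 2)) ∂μ := by
          refine Finset.sum_congr rfl fun η _ => ?_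
          rw [lintegral_indicator (hm _ (hfib η)), Measure.restrict_restrict (hm _ (hfib η)),
            Set.inter_comm]
      _ ≤ ∑ η ∈ hfin.toFinset, μ (A ∩ y ⁻¹' {η}) :=
          Finset.sum_le_sum fun η _ => h.setLIntegral_exp_le hm η (hA.inter (hfib η))
      _ = μ (⋃ η ∈ hfin.toFinset, A ∩ y ⁻¹' {η}) := by
          rw [measure_biUnion_finset]
          · intro η _ η' _ hne
            refine Set.disjoint_left.2 fun ω h1 h2 => hne ?_
            rw [← (show y ω = η from h1.2), (show y ω = η' from h2.2)]
          · exact fun η _ => hm _ (hA.inter (hfib η))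
      _ ≤ μ A := measure_mono (Set.iUnion₂_subset fun η _ => Set.inter_subset_left)
  · intro η _
    refine Measurable.indicator ?_ (hm _ (hfib η))
    fun_prop

lemma CondSubGaussian.setLIntegral_exp_measurable_le (h : CondSubGaussian μ m ζ v) (hm : m ≤ mΩ)
    (hζ : Measurable ζ) {y : Ω → ℝ} (hy : Measurable[m] y) {A : Set Ω} (hA : MeasurableSet[m] A) :
    ∫⁻ ω in A, ENNReal.ofReal (Real.exp (y ω * ζ ω - y ω ^ 2 * v / 2)) ∂μ ≤ μ A := by
  have hsm : StronglyMeasurable[m] y := hy.stronglyMeasurable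
  have hlim : ∀ ω, Filter.Tendsto (fun k => ENNReal.ofReal
      (Real.exp (hsm.approx k ω * ζ ω - hsm.approx k ω ^ 2 * v / 2))) Filter.atTop
      (nhds (ENNReal.ofReal (Real.exp (y ω * ζ ω - y ω ^ 2 * v / 2)))) := by
    intro ω
    have hc : Continuous fun s : ℝ =>
        ENNReal.ofReal (Real.exp (s * ζ ω - s ^ 2 * v / 2)) :=
      ENNReal.continuous_ofReal.comp (by fun_prop)
    exact (hc.tendsto _).comp (hsm.tendsto_approx ω)
  calc ∫⁻ ω in A, ENNReal.ofReal (Real.exp (y ω * ζ ω - y ω ^ 2 * v / 2)) ∂μ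
      = ∫⁻ ω in A, Filter.liminf (fun k => ENNReal.ofReal
        (Real.exp (hsm.approx k ω * ζ ω - hsm.approx k ω ^ 2 * v / 2))) Filter.atTop ∂μ := by
        simp only [fun ω => (hlim ω).liminf_eq]
    _ ≤ Filter.liminf (fun k => ∫⁻ ω in A, ENNReal.ofReal
        (Real.exp (hsm.approx k ω * ζ ω - hsm.approx k ω ^ 2 * v / 2)) ∂μ) Filter.atTop := by
        refine lintegral_liminf_le fun k => ?_
        have hk : Measurable (hsm.approx k) :=
          (@SimpleFunc.measurable Ω ℝ m _ (hsm.approx k)).mono hm le_rfl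
        fun_prop
    _ ≤ Filter.liminf (fun _ : ℕ => μ A) Filter.atTop :=
        Filter.liminf_le_liminf (Filter.Eventually.of_forall fun k =>
          h.setLIntegral_exp_finite_le hm hζ (@SimpleFunc.measurable Ω ℝ m _ (hsm.approx k))
            (@SimpleFunc.finite_range Ω ℝ m (hsm.approx k)) hA)
    _ = μ A := Filter.liminf_const _

/-- The bounds on the sets of `m` say that the measure with the exponential as density is dominated
by `μ` on `m`. Domination passes to integrals of `m`-measurable functions, so `Y` needs no
integrability. -/
lemma CondSubGaussian.lintegral_mul_exp_le (h : CondSubGaussian μ m ζ v) (hm : m ≤ mΩ)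
    (hζ : Measurable ζ) {y : Ω → ℝ} (hy : Measurable[m] y) {Y : Ω → ℝ≥0∞}
    (hY : Measurable[m] Y) :
    ∫⁻ ω, Y ω * ENNReal.ofReal (Real.exp (y ω * ζ ω - y ω ^ 2 * v / 2)) ∂μ ≤ ∫⁻ ω, Y ω ∂μ := by
  set g : Ω → ℝ≥0∞ := fun ω => ENNReal.ofReal (Real.exp (y ω * ζ ω - y ω ^ 2 * v / 2)) with hg
  have hym : Measurable y := hy.mono hm le_rfl
  have hgm : Measurable g := by fun_prop
  have hYm : Measurable Y := hY.mono hm le_rfl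
  have hle : (μ.withDensity g).trim hm ≤ μ.trim hm := by
    refine Measure.le_iff.2 fun A hA => ?_
    rw [trim_measurableSet_eq hm hA, trim_measurableSet_eq hm hA, withDensity_apply _ (hm _ hA)]
    exact h.setLIntegral_exp_measurable_le hm hζ hy hA
  calc ∫⁻ ω, Y ω * g ω ∂μ = ∫⁻ ω, Y ω ∂(μ.withDensity g) := by
        rw [lintegral_withDensity_eq_lintegral_mul _ hgm hYm]
        simp only [Pi.mul_apply, mul_comm]
    _ = ∫⁻ ω, Y ω ∂((μ.withDensity g).trim hm) := (lintegral_trim hm hY).symm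
    _ ≤ ∫⁻ ω, Y ω ∂(μ.trim hm) := lintegral_mono' hle le_rfl
    _ = ∫⁻ ω, Y ω ∂μ := lintegral_trim hm hY

/-- Completing the square: the exponential times the standard Gaussian density is a constant times
the Gaussian density of mean √w (x - a)/(1 + w) and variance 1/(1 + w). With a = ⟪φ_t, R_t S_t⟫ and
w = ⟪φ_t, R_t φ_t⟫, the constant is the one-step factor of the mixture process. -/
lemma lintegral_exp_gaussianReal (x a : ℝ) {w : ℝ} (hw : 0 ≤ w) :
    ∫⁻ g, ENNReal.ofReal (Real.exp ((a + √w * g) * x - (a + √w * g) ^ 2 * 1 / 2))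
        ∂(gaussianReal 0 1) =
      ENNReal.ofReal ((√(1 + w))⁻¹ *
        Real.exp ((2 * x * a + x ^ 2 * w - a ^ 2) / (1 + w) / 2)) := by
  have hw1 : 0 < 1 + w := by linarith
  set v' : NNReal := ⟨(1 + w)⁻¹, by positivity⟩ with hv'
  have hv'0 : v' ≠ 0 := by
    intro h0
    have : (1 + w)⁻¹ = 0 := congrArg NNReal.toReal h0
    exact (inv_pos.2 hw1).ne' this
  set m' : ℝ := √w * (x - a) / (1 + w) with hm'
  rw [gaussianReal_of_var_ne_zero _ one_ne_zero, lintegral_withDensity_eq_lintegral_mul _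
    (measurable_gaussianPDF _ _) (by fun_prop)]
  have hpt : ∀ g : ℝ, (gaussianPDF 0 1 * fun g => ENNReal.ofReal
      (Real.exp ((a + √w * g) * x - (a + √w * g) ^ 2 * 1 / 2))) g =
      ENNReal.ofReal ((√(1 + w))⁻¹ *
        Real.exp ((2 * x * a + x ^ 2 * w - a ^ 2) / (1 + w) / 2)) * gaussianPDF m' v' g := by
    intro g
    rw [Pi.mul_apply, gaussianPDF, gaussianPDF, ← ENNReal.ofReal_mul (gaussianPDFReal_nonneg _ _ _),
      ← ENNReal.ofReal_mul (by positivity)]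
    congr 1
    rw [gaussianPDFReal, gaussianPDFReal]
    have hv : (v' : ℝ) = (1 + w)⁻¹ := rfl
    have hroot : (√(2 * Real.pi * (v' : ℝ)))⁻¹ = (√(2 * Real.pi * (1 : NNReal)))⁻¹ * √(1 + w) := by
      rw [hv, Real.sqrt_mul (by positivity), Real.sqrt_inv, mul_inv, inv_inv]
      simp
    have hs : √(1 + w) ≠ 0 := (Real.sqrt_pos.2 hw1).ne'
    rw [hroot, mul_assoc, ← Real.exp_add]
    have hexp : -(g - 0) ^ 2 / (2 * ((1 : NNReal) : ℝ)) +
        ((a + √w * g) * x - (a + √w * g) ^ 2 * 1 / 2) =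
        (2 * x * a + x ^ 2 * w - a ^ 2) / (1 + w) / 2 + -(g - m') ^ 2 / (2 * (v' : ℝ)) := by
      rw [hv, hm']
      have hsq : √w ^ 2 = w := Real.sq_sqrt hw
      rw [NNReal.coe_one]
      generalize √w = r at hsq ⊢
      subst hsq
      field_simp
      ring
    rw [hexp, Real.exp_add]
    field_simp
  simp only [hpt]
  rw [lintegral_const_mul _ (measurable_gaussianPDF _ _), lintegral_gaussianPDF_eq_one _ hv'0,
    mul_one]

/-- One step of the method of mixtures with a Gaussian mixing distribution. -/
lemma CondSubGaussian.lintegral_mul_mixture_le (h : CondSubGaussian μ m ζ 1) (hm : m ≤ mΩ)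
    (hζ : Measurable ζ) {a w : Ω → ℝ} (ha : Measurable[m] a) (hw : Measurable[m] w)
    (hw0 : ∀ ω, 0 ≤ w ω) {Y : Ω → ℝ≥0∞} (hY : Measurable[m] Y) :
    ∫⁻ ω, Y ω * ENNReal.ofReal ((√(1 + w ω))⁻¹ *
      Real.exp ((2 * ζ ω * a ω + ζ ω ^ 2 * w ω - a ω ^ 2) / (1 + w ω) / 2)) ∂μ ≤
      ∫⁻ ω, Y ω ∂μ := by
  have ham : Measurable a := ha.mono hm le_rfl
  have hwm : Measurable w := hw.mono hm le_rfl
  have hYm : Measurable Y := hY.mono hm le_rfl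
  calc _ = ∫⁻ ω, ∫⁻ g, Y ω * ENNReal.ofReal (Real.exp ((a ω + √(w ω) * g) * ζ ω -
          (a ω + √(w ω) * g) ^ 2 * 1 / 2)) ∂(gaussianReal 0 1) ∂μ := by
        refine lintegral_congr fun ω => ?_
        rw [lintegral_const_mul _ (by fun_prop), lintegral_exp_gaussianReal _ _ (hw0 ω)]
    _ = ∫⁻ g, ∫⁻ ω, Y ω * ENNReal.ofReal (Real.exp ((a ω + √(w ω) * g) * ζ ω -
          (a ω + √(w ω) * g) ^ 2 * 1 / 2)) ∂μ ∂(gaussianReal 0 1) := by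
        refine lintegral_lintegral_swap (Measurable.aemeasurable ?_)
        unfold Function.uncurry
        fun_prop
    _ ≤ ∫⁻ _, ∫⁻ ω, Y ω ∂μ ∂(gaussianReal 0 1) := by
        refine lintegral_mono fun g => h.lintegral_mul_exp_le hm hζ ?_ hY
        have : Measurable[m] fun ω => √(w ω) := Real.continuous_sqrt.measurable.comp hw
        exact ha.add (this.mul_const g)
    _ = ∫⁻ ω, Y ω ∂μ := by simp

omit [IsFiniteMeasure μ] in
lemma CondSubGaussian.div_const (h : CondSubGaussian μ m ζ v) {r : ℝ} (hr : 0 < r)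
    (hv : v ≤ r ^ 2) : CondSubGaussian μ m (fun ω => ζ ω / r) 1 := by
  intro η
  obtain ⟨h1, h2⟩ := h (η / r)
  have he : (fun ω => Real.exp (η * (ζ ω / r))) = fun ω => Real.exp (η / r * ζ ω) := by
    ext ω; congr 1; ring
  rw [he]
  refine ⟨h1, h2.trans (Filter.Eventually.of_forall fun ω => ?_)⟩
  refine Real.exp_le_exp.2 ?_
  rw [div_pow]
  have : η ^ 2 / r ^ 2 * v ≤ η ^ 2 / r ^ 2 * r ^ 2 := by gcongr
  rw [div_mul_cancel₀ _ (by positivity)] at this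
  linarith

end SubGaussian

/-! ### Maximal inequality. -/

section Ville

/-- Ville's maximal inequality for nonnegative supermartingales, over a finite horizon. -/
lemma mul_measure_exists_le {Ω : Type*} {mΩ : MeasurableSpace Ω} {μ : Measure Ω}
    {ℱ : Filtration ℕ mΩ} {M : ℕ → Ω → ℝ≥0∞} (hM : ∀ t, Measurable[ℱ t] (M t))
    (hstep : ∀ t, ∀ A, MeasurableSet[ℱ t] A →
      ∫⁻ ω in A, M (t + 1) ω ∂μ ≤ ∫⁻ ω in A, M t ω ∂μ) (K : ℝ≥0∞) (n : ℕ) :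
    K * μ {ω | ∃ t ≤ n, K ≤ M t ω} ≤ ∫⁻ ω, M 0 ω ∂μ := by
  have hlev : ∀ t, MeasurableSet[ℱ t] {ω | K ≤ M t ω} := fun t =>
    hM t measurableSet_Ici
  have hcross : ∀ t, MeasurableSet[ℱ t] {ω | ∃ s ≤ t, K ≤ M s ω} := by
    intro t
    have : {ω | ∃ s ≤ t, K ≤ M s ω} = ⋃ s ∈ Set.Iic t, {ω | K ≤ M s ω} := by
      ext ω; simp
    rw [this]
    exact MeasurableSet.biUnion (Set.to_countable _) fun s hs => ℱ.mono hs _ (hlev s)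
  have hmark : ∀ t, ∀ A, MeasurableSet A → K * μ (A ∩ {ω | K ≤ M t ω}) ≤
      ∫⁻ ω in A ∩ {ω | K ≤ M t ω}, M t ω ∂μ := by
    intro t A hA
    rw [← setLIntegral_const]
    exact setLIntegral_mono' (hA.inter (ℱ.le t _ (hlev t))) fun ω hω => hω.2
  -- This is the expectation of the process frozen at the first crossing, with the frozen value
  -- replaced by its lower bound K. In this form the quantity does not increase with t.
  have key : ∀ t, K * μ {ω | ∃ s ≤ t, K ≤ M s ω} +
      ∫⁻ ω in {ω | ∃ s ≤ t, K ≤ M s ω}ᶜ, M t ω ∂μ ≤ ∫⁻ ω, M 0 ω ∂μ := by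
    intro t
    induction t with
    | zero =>
      have h0 : {ω | ∃ s ≤ 0, K ≤ M s ω} = {ω | K ≤ M 0 ω} := by ext ω; simp
      rw [h0]
      refine le_trans (add_le_add ?_ le_rfl) (lintegral_add_compl (M 0) (ℱ.le 0 _ (hlev 0))).le
      simpa using hmark 0 Set.univ MeasurableSet.univ
    | succ t ih =>
      set C := {ω | ∃ s ≤ t, K ≤ M s ω} with hC
      set D := {ω | K ≤ M (t + 1) ω} with hD
      have hCm : MeasurableSet C := ℱ.le t _ (hcross t)
      have hDm : MeasurableSet D := ℱ.le _ _ (hlev (t + 1))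
      have hunion : {ω | ∃ s ≤ t + 1, K ≤ M s ω} = C ∪ (Cᶜ ∩ D) := by
        have h1 : C ∪ (Cᶜ ∩ D) = C ∪ D := by ext ω; by_cases h : ω ∈ C <;> simp [h]
        rw [h1]
        ext ω
        constructor
        · rintro ⟨s, hs, h⟩
          rcases Nat.le_succ_iff.1 hs with h1 | h1
          · exact Or.inl ⟨s, h1, h⟩
          · subst h1; exact Or.inr h
        · rintro (⟨s, hs, h⟩ | h)
          · exact ⟨s, hs.trans (Nat.le_succ t), h⟩
          · exact ⟨t + 1, le_rfl, h⟩
      have hcompl : (C ∪ (Cᶜ ∩ D))ᶜ = Cᶜ ∩ Dᶜ := by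
        ext ω; by_cases h : ω ∈ C <;> simp [h]
      refine le_trans ?_ ih
      rw [hunion, hcompl]
      calc K * μ (C ∪ (Cᶜ ∩ D)) + ∫⁻ ω in Cᶜ ∩ Dᶜ, M (t + 1) ω ∂μ
          ≤ (K * μ C + ∫⁻ ω in Cᶜ ∩ D, M (t + 1) ω ∂μ) +
            ∫⁻ ω in Cᶜ ∩ Dᶜ, M (t + 1) ω ∂μ := by
            gcongr
            refine (mul_le_mul_right (measure_union_le _ _) _).trans ?_
            rw [mul_add]
            gcongr
            exact hmark (t + 1) Cᶜ hCm.compl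
        _ = K * μ C + ∫⁻ ω in Cᶜ, M (t + 1) ω ∂μ := by
            rw [add_assoc, ← lintegral_inter_add_sdiff (M (t + 1)) Cᶜ hDm, Set.sdiff_eq]
        _ ≤ K * μ C + ∫⁻ ω in Cᶜ, M t ω ∂μ := by
            exact add_le_add le_rfl (hstep t _ (hcross t).compl)
  exact le_trans le_self_add (key n)

end Ville

/-! ### The self-normalized noise and its supermartingale. -/

section Mixture

open scoped InnerProductSpace

variable {E : Type*} [NormedAddCommGroup E] [InnerProductSpace ℝ E]

/-- The noise aggregated along the features of the first `t` rounds. -/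
def noiseSum (φ : ℕ → E) (ξ : ℕ → ℝ) (t : ℕ) : E := ∑ s ∈ Finset.range t, ξ s • φ s

lemma noiseSum_succ (φ : ℕ → E) (ξ : ℕ → ℝ) (t : ℕ) :
    noiseSum φ ξ (t + 1) = noiseSum φ ξ t + ξ t • φ t := by
  rw [noiseSum, noiseSum, Finset.sum_range_succ]

/-- The squared self-normalized norm `⟪S_t, R_t S_t⟫` of the aggregated noise. -/
def noiseForm (c : ℝ) (φ : ℕ → E) (ξ : ℕ → ℝ) (t : ℕ) : ℝ :=
  ⟪noiseSum φ ξ t, resolvent c φ t (noiseSum φ ξ t)⟫_ℝ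

lemma noiseForm_div (c : ℝ) (φ : ℕ → E) (ξ : ℕ → ℝ) (r : ℝ) (t : ℕ) :
    noiseForm c φ (fun s => ξ s / r) t = noiseForm c φ ξ t / r ^ 2 := by
  have h : noiseSum φ (fun s => ξ s / r) t = r⁻¹ • noiseSum φ ξ t := by
    rw [noiseSum, noiseSum, Finset.smul_sum]
    refine Finset.sum_congr rfl fun s _ => ?_
    rw [smul_smul, div_eq_inv_mul]
  rw [noiseForm, h, map_smul, inner_smul_left, inner_smul_right, noiseForm]
  simp only [conj_trivial]
  field_simp

/-- The mixture supermartingale `exp ((⟪S_t, R_t S_t⟫ - log det) / 2)`. -/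
def mixture (c : ℝ) (φ : ℕ → E) (ξ : ℕ → ℝ) (t : ℕ) : ℝ :=
  Real.exp ((noiseForm c φ ξ t - logVolume c φ t) / 2)

lemma mixture_zero (c : ℝ) (φ : ℕ → E) (ξ : ℕ → ℝ) : mixture c φ ξ 0 = 1 := by
  simp [mixture, noiseForm, noiseSum, logVolume]

/-- Factoring out one round allows mixing over a fresh one-dimensional Gaussian each time, instead
of over a Gaussian on `E`. -/
lemma mixture_succ {c : ℝ} (hc : 0 < c) (φ : ℕ → E) (ξ : ℕ → ℝ) (t : ℕ) :
    mixture c φ ξ (t + 1) = mixture c φ ξ t *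
      ((√(1 + ⟪φ t, resolvent c φ t (φ t)⟫_ℝ))⁻¹ *
        Real.exp ((2 * ξ t * ⟪φ t, resolvent c φ t (noiseSum φ ξ t)⟫_ℝ +
          ξ t ^ 2 * ⟪φ t, resolvent c φ t (φ t)⟫_ℝ -
          ⟪φ t, resolvent c φ t (noiseSum φ ξ t)⟫_ℝ ^ 2) /
          (1 + ⟪φ t, resolvent c φ t (φ t)⟫_ℝ) / 2)) := by
  have hw : 0 < 1 + ⟪φ t, resolvent c φ t (φ t)⟫_ℝ := by
    linarith [inner_resolvent_self_nonneg hc φ t (φ t)]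
  have hs : (√(1 + ⟪φ t, resolvent c φ t (φ t)⟫_ℝ))⁻¹ =
      Real.exp (-(Real.log (1 + ⟪φ t, resolvent c φ t (φ t)⟫_ℝ) / 2)) := by
    rw [Real.exp_neg, ← Real.log_sqrt hw.le, Real.exp_log (Real.sqrt_pos.2 hw)]
  rw [mixture, mixture, hs, ← Real.exp_add, ← Real.exp_add, noiseForm, noiseSum_succ,
    inner_resolvent_succ_update hc, logVolume, Finset.sum_range_succ, noiseForm, logVolume]
  congr 1
  ring

section Measurability

variable [MeasurableSpace E] [BorelSpace E] [SecondCountableTopology E]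
  {Ω : Type*} {m : MeasurableSpace Ω}

lemma measurable_resolvent (c : ℝ) {φ : Ω → ℕ → E} {t : ℕ}
    (hφ : ∀ s < t, Measurable fun ω => φ ω s) {u : Ω → E} (hu : Measurable u) :
    Measurable fun ω => resolvent c (φ ω) t (u ω) := by
  induction t generalizing u with
  | zero => exact hu.const_smul c⁻¹
  | succ t ih =>
    have hφt := hφ t (Nat.lt_succ_self t)
    have h1 := ih (fun s hs => hφ s (hs.trans (Nat.lt_succ_self t))) hu
    have h2 := ih (fun s hs => hφ s (hs.trans (Nat.lt_succ_self t))) hφt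
    simp only [resolvent_succ]
    exact h1.sub ((((hφt.inner h2).const_add 1).inv.mul (hφt.inner h1)).smul h2)

lemma measurable_inner_resolvent (c : ℝ) {φ : Ω → ℕ → E} {t : ℕ}
    (hφ : ∀ s < t, Measurable fun ω => φ ω s) {u v : Ω → E} (hu : Measurable u)
    (hv : Measurable v) : Measurable fun ω => ⟪u ω, resolvent c (φ ω) t (v ω)⟫_ℝ :=
  hu.inner (measurable_resolvent c hφ hv)

lemma measurable_noiseSum {φ : Ω → ℕ → E} {ξ : ℕ → Ω → ℝ} {t : ℕ}
    (hφ : ∀ s < t, Measurable fun ω => φ ω s) (hξ : ∀ s < t, Measurable (ξ s)) :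
    Measurable fun ω => noiseSum (φ ω) (fun s => ξ s ω) t := by
  simp only [noiseSum]
  exact Finset.measurable_sum _ fun s hs =>
    (hξ s (Finset.mem_range.1 hs)).smul (hφ s (Finset.mem_range.1 hs))

lemma measurable_logVolume (c : ℝ) {φ : Ω → ℕ → E} {t : ℕ}
    (hφ : ∀ s < t, Measurable fun ω => φ ω s) :
    Measurable fun ω => logVolume c (φ ω) t := by
  simp only [logVolume]
  refine Finset.measurable_sum _ fun s hs => ?_
  have hs' := Finset.mem_range.1 hs
  exact ((measurable_inner_resolvent c (fun r hr => hφ r (hr.trans hs')) (hφ s hs')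
    (hφ s hs')).const_add 1).log

lemma measurable_mixture (c : ℝ) {φ : Ω → ℕ → E} {ξ : ℕ → Ω → ℝ} {t : ℕ}
    (hφ : ∀ s < t, Measurable fun ω => φ ω s) (hξ : ∀ s < t, Measurable (ξ s)) :
    Measurable fun ω => mixture c (φ ω) (fun s => ξ s ω) t := by
  have h := measurable_noiseSum hφ hξ
  exact (((measurable_inner_resolvent c hφ h h).sub (measurable_logVolume c hφ)).div_const 2).exp

end Measurability

/-- The self-normalized maximal inequality for the method of mixtures. -/
theorem mul_measure_exists_le_mixture [FiniteDimensional ℝ E] {Ω : Type*}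
    {mΩ : MeasurableSpace Ω} {μ : Measure Ω} [IsProbabilityMeasure μ] {ℱ : Filtration ℕ mΩ}
    {𝒢 : ℕ → MeasurableSpace Ω} (h𝒢 : ∀ t, ℱ t ≤ 𝒢 t) (h𝒢' : ∀ t, 𝒢 t ≤ ℱ (t + 1))
    {φ : Ω → ℕ → E} (hφ : ∀ t, Measurable[𝒢 t, borel E] fun ω => φ ω t)
    {ξ : ℕ → Ω → ℝ} (hξ : ∀ t, Measurable[ℱ (t + 1)] (ξ t))
    (hsub : ∀ t, CondSubGaussian μ (𝒢 t) (ξ t) 1) {c : ℝ} (hc : 0 < c) (K : ℝ) (n : ℕ) :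
    ENNReal.ofReal K * μ {ω | ∃ t ≤ n, K ≤ mixture c (φ ω) (fun s => ξ s ω) t} ≤ 1 := by
  borelize E
  have hprop : ProperSpace E := FiniteDimensional.proper ℝ E
  have hφ' : ∀ s t, s < t → Measurable[ℱ t] fun ω => φ ω s := fun s t hst =>
    (hφ s).mono ((h𝒢' s).trans (ℱ.mono hst)) le_rfl
  have hξ' : ∀ s t, s < t → Measurable[ℱ t] (ξ s) := fun s t hst =>
    (hξ s).mono (ℱ.mono hst) le_rfl
  set M : ℕ → Ω → ℝ≥0∞ := fun t ω =>
    ENNReal.ofReal (mixture c (φ ω) (fun s => ξ s ω) t) with hMdef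
  have hM : ∀ t, Measurable[ℱ t] (M t) := fun t => ENNReal.measurable_ofReal.comp
    (measurable_mixture c (fun s hs => hφ' s t hs) (fun s hs => hξ' s t hs))
  have hstep : ∀ t, ∀ A, MeasurableSet[ℱ t] A →
      ∫⁻ ω in A, M (t + 1) ω ∂μ ≤ ∫⁻ ω in A, M t ω ∂μ := by
    intro t A hA
    have hAm := ℱ.le t _ hA
    rw [← lintegral_indicator hAm, ← lintegral_indicator hAm]
    have hφG : ∀ s < t, Measurable[𝒢 t] fun ω => φ ω s := fun s hs =>
      (hφ' s t hs).mono (h𝒢 t) le_rfl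
    -- The Gaussian parameters ⟪φ_t, R_t S_t⟫ and ⟪φ_t, R_t φ_t⟫ are known given `𝒢 t`, which
    -- includes the pair of round t but is the σ-algebra on which the noise is still sub-Gaussian.
    have hS : Measurable[𝒢 t] fun ω => noiseSum (φ ω) (fun s => ξ s ω) t :=
      measurable_noiseSum hφG fun s hs => (hξ' s t hs).mono (h𝒢 t) le_rfl
    have hY : Measurable[𝒢 t] (A.indicator (M t)) :=
      ((hM t).mono (h𝒢 t) le_rfl).indicator (h𝒢 t _ hA)
    refine le_trans (le_of_eq ?_) ((hsub t).lintegral_mul_mixture_le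
      ((h𝒢' t).trans (ℱ.le _)) ((hξ t).mono (ℱ.le _) le_rfl)
      (measurable_inner_resolvent c hφG (hφ t) hS)
      (measurable_inner_resolvent c hφG (hφ t) (hφ t))
      (fun ω => inner_resolvent_self_nonneg hc _ _ _) hY)
    refine lintegral_congr fun ω => ?_
    by_cases hω : ω ∈ A
    · rw [Set.indicator_of_mem hω, Set.indicator_of_mem hω, hMdef]
      beta_reduce
      rw [mixture_succ hc, ENNReal.ofReal_mul (show 0 ≤ mixture c (φ ω) (fun s => ξ s ω) t from (Real.exp_pos _).le)]
    · simp [Set.indicator_of_notMem hω]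
  have h := mul_measure_exists_le hM hstep (ENNReal.ofReal K) n
  have h0 : ∫⁻ ω, M 0 ω ∂μ = 1 := by simp [hMdef, mixture_zero]
  rw [h0] at h
  refine le_trans (mul_le_mul_right (measure_mono ?_) _) h
  rintro ω ⟨t, ht, hK⟩
  exact ⟨t, ht, ENNReal.ofReal_le_ofReal hK⟩

end Mixture

/-! ### Predicted against realized information gain. -/

section Bernoulli

variable {Ω : Type*} {mΩ : MeasurableSpace Ω} {μ : Measure Ω} [IsProbabilityMeasure μ]
  {ℱ : Filtration ℕ mΩ} {b : ℕ → Ω → Bool} {p h : ℕ → Ω → ℝ}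

/-- The indicator of `b`. -/
def bit (b : Bool) : ℝ := if b then 1 else 0

lemma bit_nonneg (b : Bool) : 0 ≤ bit b := by cases b <;> simp [bit]

lemma bit_le_one (b : Bool) : bit b ≤ 1 := by cases b <;> simp [bit]

lemma measurable_bit : Measurable bit := measurable_from_top

lemma integral_mul_bit (hb : ∀ t, Measurable[ℱ (t + 1)] (b t))
    (hlaw : ∀ t, μ[fun ω => bit (b t ω) | ℱ t] =ᵐ[μ] p t) (t : ℕ) {Z : Ω → ℝ}
    (hZ : Measurable[ℱ t] Z) {K : ℝ} (hK : ∀ ω, |Z ω| ≤ K) :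
    ∫ ω, Z ω * bit (b t ω) ∂μ = ∫ ω, Z ω * p t ω ∂μ := by
  have hbm : Measurable fun ω => bit (b t ω) :=
    measurable_bit.comp ((hb t).mono (ℱ.le _) le_rfl)
  have hbint : Integrable (fun ω => bit (b t ω)) μ :=
    Integrable.of_bound hbm.aestronglyMeasurable 1 (Filter.Eventually.of_forall fun ω => by
      rw [Real.norm_eq_abs, abs_of_nonneg (bit_nonneg _)]; exact bit_le_one _)
  have hint : Integrable (Z * fun ω => bit (b t ω)) μ :=
    hbint.bdd_mul (hZ.mono (ℱ.le t) le_rfl).aestronglyMeasurable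
      (Filter.Eventually.of_forall hK)
  have h1 := condExp_mul_of_stronglyMeasurable_left hZ.stronglyMeasurable hint hbint
  have h2 : μ[Z * fun ω => bit (b t ω) | ℱ t] =ᵐ[μ] fun ω => Z ω * p t ω := by
    filter_upwards [h1, hlaw t] with ω h3 h4
    rw [h3, Pi.mul_apply, h4]
  rw [← integral_congr_ae h2, integral_condExp (ℱ.le t)]
  rfl

/-- A Bernoulli variable vanishes almost surely where its parameter does. -/
lemma measure_bit_of_param_zero (hb : ∀ t, Measurable[ℱ (t + 1)] (b t))
    (hp : ∀ t, Measurable[ℱ t] (p t))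
    (hlaw : ∀ t, μ[fun ω => bit (b t ω) | ℱ t] =ᵐ[μ] p t) (t : ℕ) :
    μ {ω | b t ω = true ∧ p t ω = 0} = 0 := by
  have hset : MeasurableSet[ℱ t] {ω | p t ω = 0} := hp t (measurableSet_singleton 0)
  have hbm : Measurable fun ω => bit (b t ω) :=
    measurable_bit.comp ((hb t).mono (ℱ.le _) le_rfl)
  have h1 := integral_mul_bit hb hlaw t (Z := {ω | p t ω = 0}.indicator 1)
    ((@measurable_const ℝ Ω _ (ℱ t) 1).indicator hset) (K := 1) (fun ω => by
      by_cases h : ω ∈ {ω | p t ω = 0}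
      · simp [Set.indicator_of_mem h]
      · simp [Set.indicator_of_notMem h])
  have h2 : ∀ ω, {ω | p t ω = 0}.indicator (1 : Ω → ℝ) ω * p t ω = 0 := by
    intro ω
    by_cases h : ω ∈ {ω | p t ω = 0}
    · rw [show p t ω = 0 from h, mul_zero]
    · rw [Set.indicator_of_notMem h, zero_mul]
  have hBm : MeasurableSet {ω | b t ω = true ∧ p t ω = 0} :=
    (((hb t).mono (ℱ.le _) le_rfl) (measurableSet_singleton true)).inter (ℱ.le t _ hset)
  have h3 : ∀ ω, {ω | p t ω = 0}.indicator (1 : Ω → ℝ) ω * bit (b t ω) =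
      {ω | b t ω = true ∧ p t ω = 0}.indicator 1 ω := by
    intro ω
    by_cases h : p t ω = 0 <;> by_cases h' : b t ω = true <;>
      simp [h, h', bit]
  simp only [h2, h3, integral_zero] at h1
  rw [integral_indicator_one hBm] at h1
  exact (measureReal_eq_zero_iff (measure_ne_top μ _)).1 h1

/-- The exponential moment comparing `∑ p_s h_s` with `∑ b_s h_s`. -/
lemma integral_exp_bernoulli_le (hb : ∀ t, Measurable[ℱ (t + 1)] (b t))
    (hp : ∀ t, Measurable[ℱ t] (p t)) (hp01 : ∀ t ω, p t ω ∈ Set.Icc (0 : ℝ) 1)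
    (hlaw : ∀ t, μ[fun ω => bit (b t ω) | ℱ t] =ᵐ[μ] p t)
    (hh : ∀ t, Measurable[ℱ t] (h t)) (hh02 : ∀ t ω, h t ω ∈ Set.Icc (0 : ℝ) 2) (n : ℕ) :
    Integrable (fun ω => Real.exp (∑ s ∈ Finset.range n,
        (p s ω * h s ω / 3 - bit (b s ω) * h s ω))) μ ∧
      ∫ ω, Real.exp (∑ s ∈ Finset.range n, (p s ω * h s ω / 3 - bit (b s ω) * h s ω)) ∂μ ≤ 1 := by
  set G : ℕ → Ω → ℝ := fun t ω => Real.exp (∑ s ∈ Finset.range t,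
    (p s ω * h s ω / 3 - bit (b s ω) * h s ω)) with hG
  have hGm : ∀ t, Measurable[ℱ t] (G t) := by
    intro t
    refine (Finset.measurable_sum _ fun s hs => ?_).exp
    have hs' : s < t := Finset.mem_range.1 hs
    have h1 : Measurable[ℱ t] (p s) := (hp s).mono (ℱ.mono hs'.le) le_rfl
    have h2 : Measurable[ℱ t] (h s) := (hh s).mono (ℱ.mono hs'.le) le_rfl
    have h3 : Measurable[ℱ t] fun ω => bit (b s ω) :=
      measurable_bit.comp ((hb s).mono (ℱ.mono hs') le_rfl)
    exact ((h1.mul h2).div_const 3).sub (h3.mul h2)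
  have hGle : ∀ t ω, G t ω ≤ Real.exp t := by
    intro t ω
    refine Real.exp_le_exp.2 ?_
    calc _ ≤ ∑ s ∈ Finset.range t, (1 : ℝ) := by
          refine Finset.sum_le_sum fun s _ => ?_
          obtain ⟨hp0, hp1⟩ := hp01 s ω
          obtain ⟨hh0, hh2⟩ := hh02 s ω
          have := mul_nonneg (bit_nonneg (b s ω)) hh0
          nlinarith
      _ = t := by simp
  have hGint : ∀ t, Integrable (G t) μ := fun t =>
    Integrable.of_bound ((hGm t).mono (ℱ.le t) le_rfl).aestronglyMeasurable (Real.exp t)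
      (Filter.Eventually.of_forall fun ω => by
        rw [Real.norm_eq_abs, abs_of_pos (Real.exp_pos _)]; exact hGle t ω)
  refine ⟨hGint n, ?_⟩
  change ∫ ω, G n ω ∂μ ≤ 1
  have hstep : ∀ t, ∫ ω, G (t + 1) ω ∂μ ≤ ∫ ω, G t ω ∂μ := by
    intro t
    have hph : ∀ ω, p t ω * h t ω ≤ 2 := fun ω => by
      obtain ⟨hp0, hp1⟩ := hp01 t ω
      obtain ⟨hh0, hh2⟩ := hh02 t ω
      nlinarith
    set Z : Ω → ℝ := fun ω => G t ω * Real.exp (p t ω * h t ω / 3) with hZ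
    set q : Ω → ℝ := fun ω => 1 - Real.exp (-h t ω) with hq
    have hq0 : ∀ ω, 0 ≤ q ω := fun ω => by
      have := Real.exp_le_one_iff.2 (neg_nonpos.2 (hh02 t ω).1)
      simp only [hq]; linarith
    have hq1 : ∀ ω, q ω ≤ 1 := fun ω => by
      have := Real.exp_pos (-h t ω)
      simp only [hq]; linarith
    have hZm : Measurable[ℱ t] Z := (hGm t).mul (((hp t).mul (hh t)).div_const 3).exp
    have hqm : Measurable[ℱ t] q := measurable_const.sub (hh t).neg.exp
    have hZ0 : ∀ ω, 0 ≤ Z ω := fun ω => (mul_pos (Real.exp_pos _) (Real.exp_pos _)).le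
    have hZle : ∀ ω, Z ω ≤ Real.exp t * Real.exp 2 := fun ω => by
      refine mul_le_mul (hGle t ω) (Real.exp_le_exp.2 ?_) (Real.exp_pos _).le (Real.exp_pos _).le
      have := hph ω
      linarith
    have hZq : ∀ ω, |Z ω * q ω| ≤ Real.exp t * Real.exp 2 := fun ω => by
      rw [abs_of_nonneg (mul_nonneg (hZ0 ω) (hq0 ω))]
      exact (mul_le_of_le_one_right (hZ0 ω) (hq1 ω)).trans (hZle ω)
    have hZint : Integrable Z μ :=
      Integrable.of_bound (hZm.mono (ℱ.le t) le_rfl).aestronglyMeasurable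
        (Real.exp t * Real.exp 2) (Filter.Eventually.of_forall fun ω => by
          rw [Real.norm_eq_abs, abs_of_nonneg (hZ0 ω)]; exact hZle ω)
    have hZqm : Measurable[ℱ t] fun ω => Z ω * q ω := hZm.mul hqm
    have hbd : ∀ {r : Ω → ℝ}, Measurable r → (∀ ω, 0 ≤ r ω) → (∀ ω, r ω ≤ 1) →
        Integrable (fun ω => Z ω * q ω * r ω) μ := by
      intro r hr h0 h1
      refine Integrable.of_bound ((hZqm.mono (ℱ.le t) le_rfl).mul hr).aestronglyMeasurable
        (Real.exp t * Real.exp 2) (Filter.Eventually.of_forall fun ω => ?_)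
      rw [Real.norm_eq_abs, abs_mul, abs_of_nonneg (h0 ω)]
      exact (mul_le_of_le_one_right (abs_nonneg _) (h1 ω)).trans (hZq ω)
    have hintb : Integrable (fun ω => Z ω * q ω * bit (b t ω)) μ := hbd (measurable_bit.comp ((hb t).mono (ℱ.le _) le_rfl))
      (fun ω => bit_nonneg (b t ω)) (fun ω => bit_le_one (b t ω))
    have hintp := hbd ((hp t).mono (ℱ.le _) le_rfl) (fun ω => (hp01 t ω).1)
      (fun ω => (hp01 t ω).2)
    -- For b in {0, 1}, exp(-bh) = 1 - b(1 - exp(-h)) is affine in b, so only the conditional mean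
    -- of b is needed.
    have heq : ∀ ω, G (t + 1) ω = Z ω - Z ω * q ω * bit (b t ω) := by
      intro ω
      simp only [hG, hZ, hq, Finset.sum_range_succ]
      rw [Real.exp_add, sub_eq_add_neg (p t ω * h t ω / 3), Real.exp_add]
      cases b t ω <;> simp [bit]
      ring
    calc ∫ ω, G (t + 1) ω ∂μ = ∫ ω, Z ω ∂μ - ∫ ω, Z ω * q ω * bit (b t ω) ∂μ := by
          rw [← integral_sub hZint hintb]
          exact integral_congr_ae (Filter.Eventually.of_forall heq)
      _ = ∫ ω, Z ω ∂μ - ∫ ω, Z ω * q ω * p t ω ∂μ := by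
          rw [integral_mul_bit hb hlaw t hZqm hZq]
      _ = ∫ ω, (Z ω - Z ω * q ω * p t ω) ∂μ := (integral_sub hZint hintp).symm
      _ ≤ ∫ ω, G t ω ∂μ := by
          refine integral_mono (hZint.sub hintp) (hGint t) fun ω => ?_
          obtain ⟨hp0, hp1⟩ := hp01 t ω
          obtain ⟨hh0, hh2⟩ := hh02 t ω
          -- The factor 3 and the range [0, 2] belong together: exp(-h) ≤ 1/(1 + h) ≤ 1 - h/3
          -- exactly when 0 ≤ h ≤ 2, among h ≥ 0 for the last inequality.
          have hqh : h t ω / 3 ≤ q ω := by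
            have h1 : Real.exp (-h t ω) ≤ (1 + h t ω)⁻¹ := by
              rw [Real.exp_neg]
              have := Real.add_one_le_exp (h t ω)
              gcongr
              linarith
            have h2 : (1 + h t ω)⁻¹ ≤ 1 - h t ω / 3 := by
              rw [inv_le_iff_one_le_mul₀ (by linarith)]
              nlinarith
            simp only [hq]; linarith
          have h3 : 1 - q ω * p t ω ≤ Real.exp (-(p t ω * h t ω / 3)) := by
            have h4 := Real.add_one_le_exp (-(p t ω * h t ω / 3))
            nlinarith
          have h5 : Z ω * Real.exp (-(p t ω * h t ω / 3)) = G t ω := by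
            simp only [hZ]
            rw [mul_assoc, ← Real.exp_add, add_neg_cancel, Real.exp_zero, mul_one]
          have h6 := mul_le_mul_of_nonneg_left h3 (hZ0 ω)
          rw [h5] at h6
          beta_reduce
          linarith
  induction n with
  | zero => simp [hG]
  | succ t ih => exact (hstep t).trans ih

/-- With high probability, `∑ p_s h_s` is controlled by `∑ b_s h_s`. -/
lemma measure_bernoulli_le (hb : ∀ t, Measurable[ℱ (t + 1)] (b t))
    (hp : ∀ t, Measurable[ℱ t] (p t)) (hp01 : ∀ t ω, p t ω ∈ Set.Icc (0 : ℝ) 1)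
    (hlaw : ∀ t, μ[fun ω => bit (b t ω) | ℱ t] =ᵐ[μ] p t)
    (hh : ∀ t, Measurable[ℱ t] (h t)) (hh02 : ∀ t ω, h t ω ∈ Set.Icc (0 : ℝ) 2) (n : ℕ) (a : ℝ) :
    μ.real {ω | 3 * (∑ s ∈ Finset.range n, bit (b s ω) * h s ω + a) ≤
      ∑ s ∈ Finset.range n, p s ω * h s ω} ≤ Real.exp (-a) := by
  obtain ⟨hint, hle⟩ := integral_exp_bernoulli_le hb hp hp01 hlaw hh hh02 n
  have h1 := mul_meas_ge_le_integral_of_nonneg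
    (Filter.Eventually.of_forall fun ω => (Real.exp_pos _).le) hint (Real.exp a)
  have h2 : {ω | 3 * (∑ s ∈ Finset.range n, bit (b s ω) * h s ω + a) ≤
      ∑ s ∈ Finset.range n, p s ω * h s ω} = {ω | Real.exp a ≤ Real.exp (∑ s ∈ Finset.range n,
        (p s ω * h s ω / 3 - bit (b s ω) * h s ω))} := by
    ext ω
    simp only [Set.mem_ofPred_eq, Real.exp_le_exp, Finset.sum_sub_distrib, ← Finset.sum_div]
    constructor <;> intro h <;> linarith
  rw [h2, Real.exp_neg, ← one_div, le_div_iff₀ (Real.exp_pos a), mul_comm]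
  exact h1.trans hle

end Bernoulli

/-! ### Deterministic analysis of one round. -/

section Round

lemma ofReal_div_le_iff {a b U : ℝ} (hb : 0 ≤ b) (hU : 0 ≤ U) :
    ENNReal.ofReal a / ENNReal.ofReal b ≤ ENNReal.ofReal U ↔ a ≤ U * b := by
  rw [ENNReal.div_le_iff_le_mul (Or.inr ENNReal.ofReal_ne_top) (Or.inl ENNReal.ofReal_ne_top),
    ← ENNReal.ofReal_mul hU, ENNReal.ofReal_le_ofReal_iff (mul_nonneg hU hb)]

lemma le_five_mul_log {x : ℝ} (h0 : 0 ≤ x) (h4 : x ≤ 4) : x ≤ 5 * Real.log (1 + x) := by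
  have h := Real.one_sub_inv_le_log_of_pos (show 0 < 1 + x by linarith)
  have h1 : x / 5 ≤ 1 - (1 + x)⁻¹ := by
    rw [le_sub_comm, inv_le_iff_one_le_mul₀ (by linarith)]
    nlinarith
  linarith

variable {X : Type*} {f g ψ : X → ℝ} {xstar xhat z : X} {r D A p : ℝ}

/-- The value of the trade-off at its minimizer. -/
lemma tradeoff_le (hψ0 : ∀ x, 0 ≤ ψ x) (hψ4 : ∀ x, ψ x ≤ 4) (hψs : ψ xhat = 0)
    (hD : 0 < D) (hgap : ∀ x, x ≠ xstar → D ≤ f xstar - f x)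
    (hconf : ∀ x, |(g x - f x) - (g xhat - f xhat)| ≤ r * √(ψ x) + D / 4)
    (hA : IsGreatest (Set.range fun x => g x - g xhat + r * √(ψ x)) A)
    (hp : p ∈ Set.Icc (0 : ℝ) 1)
    (hopt : ∀ z', ∀ p' ∈ Set.Icc (0 : ℝ) 1,
      ENNReal.ofReal (((1 - p) * A + p * (A + g xhat - g z)) ^ 2) /
          ENNReal.ofReal (p * Real.log (1 + ψ z)) ≤
        ENNReal.ofReal (((1 - p') * A + p' * (A + g xhat - g z')) ^ 2) /
          ENNReal.ofReal (p' * Real.log (1 + ψ z'))) :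
    (A + p * (g xhat - g z)) ^ 2 ≤ 5 * r ^ 2 * (p * Real.log (1 + ψ z)) ∧
      (A < D / 4 → xhat = xstar ∧
        (A + p * (g xhat - g z)) ^ 2 ≤ 80 * A * r ^ 2 / D * (p * Real.log (1 + ψ z))) := by
  have hI0 : ∀ x, 0 ≤ Real.log (1 + ψ x) := fun x => Real.log_nonneg (by linarith [hψ0 x])
  have hI : ∀ x, ψ x ≤ 5 * Real.log (1 + ψ x) := fun x => le_five_mul_log (hψ0 x) (hψ4 x)
  have hA0 : 0 ≤ A := by
    have := hA.2 ⟨xhat, rfl⟩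
    simpa [hψs] using this
  -- Any bound on the ratio at a competitor transfers to the minimizer. Writing it multiplicatively
  -- covers zero denominators.
  have hcomp : ∀ U, 0 ≤ U → ∀ z', ∀ p' ∈ Set.Icc (0 : ℝ) 1,
      (A + p' * (g xhat - g z')) ^ 2 ≤ U * (p' * Real.log (1 + ψ z')) →
      (A + p * (g xhat - g z)) ^ 2 ≤ U * (p * Real.log (1 + ψ z)) := by
    intro U hU z' p' hp' h
    have h1 := hopt z' p' hp'
    rw [show (1 - p) * A + p * (A + g xhat - g z) = A + p * (g xhat - g z) by ring,
      show (1 - p') * A + p' * (A + g xhat - g z') = A + p' * (g xhat - g z') by ring] at h1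
    rw [← ofReal_div_le_iff (mul_nonneg hp.1 (hI0 z)) hU]
    exact h1.trans ((ofReal_div_le_iff (mul_nonneg hp'.1 (hI0 z')) hU).2 h)
  obtain ⟨z', hz'⟩ := hA.1
  have hz1 : A + (g xhat - g z') = r * √(ψ z') := by rw [← hz']; ring
  have hz2 : (A + (g xhat - g z')) ^ 2 = r ^ 2 * ψ z' := by
    rw [hz1, mul_pow, Real.sq_sqrt (hψ0 z')]
  refine ⟨hcomp (5 * r ^ 2) (by positivity) z' 1 (by simp) ?_, fun hlt => ?_⟩
  · rw [one_mul, one_mul, hz2]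
    nlinarith [hI z', sq_nonneg r]
  -- If the empirical maximizer were wrong, its regret of at least D would force A ≥ D - D/4, the
  -- loss D/4 being the tolerated error.
  have hxs : xhat = xstar := by
    by_contra hne
    have h1 := hgap xhat hne
    have h2 := abs_le.1 (hconf xstar)
    have h3 := hA.2 ⟨xstar, rfl⟩
    beta_reduce at h3
    linarith [h2.1]
  refine ⟨hxs, ?_⟩
  rcases hA0.eq_or_lt with h0 | hpos
  -- For A = 0 the competitor p' = 0 has objective 0/0 = 0, so the optimal numerator vanishes.
  · refine hcomp _ (by positivity) xhat 0 (by simp) ?_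
    simp [← h0]
  have hne : z' ≠ xhat := by
    rintro rfl
    rw [sub_self, hψs, Real.sqrt_zero] at hz1
    linarith
  have h1 := hgap z' (hxs ▸ hne)
  have h2 := abs_le.1 (hconf z')
  rw [← hxs] at h1
  have hg' : D / 4 ≤ g xhat - g z' := by linarith [h2.2]
  set g' := g xhat - g z' with hg'def
  have hg'pos : 0 < g' := by linarith
  -- The choice p' = A/g' makes the two parts of the numerator equal, which becomes (2A)²; it is at
  -- most 1 because A < D/4 ≤ g'.
  refine hcomp _ (by positivity) z' (A / g') ⟨by positivity, (div_le_one hg'pos).2 (by linarith)⟩ ?_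
  rw [← hg'def, div_mul_cancel₀ _ hg'pos.ne']
  have h3 : g' ^ 2 ≤ 5 * (r ^ 2 * Real.log (1 + ψ z')) := by
    have h4 : g' ^ 2 ≤ r ^ 2 * ψ z' := by rw [← hz2]; gcongr; linarith
    nlinarith [hI z', sq_nonneg r]
  have h5 : 80 * A * r ^ 2 / D * (A / g' * Real.log (1 + ψ z')) =
      16 * A ^ 2 / (D * g') * (5 * (r ^ 2 * Real.log (1 + ψ z'))) := by
    field_simp
    ring
  rw [h5]
  calc (A + A) ^ 2 = 16 * A ^ 2 / (D * g') * ((D / 4) * g') := by field_simp; ring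
    _ ≤ 16 * A ^ 2 / (D * g') * g' ^ 2 := by
      rw [sq g']
      gcongr
    _ ≤ _ := by gcongr

/-- The regret of a round, with and without feedback, in terms of its information gain. -/
lemma round_regret_le (hψ0 : ∀ x, 0 ≤ ψ x) (hψ4 : ∀ x, ψ x ≤ 4) (hψs : ψ xhat = 0)
    (hD : 0 < D) (hgap : ∀ x, x ≠ xstar → D ≤ f xstar - f x) (hmax : ∀ x, g x ≤ g xhat)
    (hconf : ∀ x, |(g x - f x) - (g xhat - f xhat)| ≤ r * √(ψ x) + D / 4)
    (hA : IsGreatest (Set.range fun x => g x - g xhat + r * √(ψ x)) A)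
    (hp : p ∈ Set.Icc (0 : ℝ) 1)
    (hopt : ∀ z', ∀ p' ∈ Set.Icc (0 : ℝ) 1,
      ENNReal.ofReal (((1 - p) * A + p * (A + g xhat - g z)) ^ 2) /
          ENNReal.ofReal (p * Real.log (1 + ψ z)) ≤
        ENNReal.ofReal (((1 - p') * A + p' * (A + g xhat - g z')) ^ 2) /
          ENNReal.ofReal (p' * Real.log (1 + ψ z'))) :
    D * (2 * (f xstar - f xhat)) ≤ 160 * r ^ 2 * (p * Real.log (1 + ψ z)) ∧
      (0 < p → D * ((f xstar - f xhat) + (f xstar - f z)) ≤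
        160 * r ^ 2 * Real.log (1 + ψ z)) := by
  obtain ⟨h1, h2⟩ := tradeoff_le hψ0 hψ4 hψs hD hgap hconf hA hp hopt
  have hI0 : 0 ≤ Real.log (1 + ψ z) := Real.log_nonneg (by linarith [hψ0 z])
  have hA0 : 0 ≤ A := by
    have := hA.2 ⟨xhat, rfl⟩
    simpa [hψs] using this
  have hg0 : 0 ≤ g xhat - g z := sub_nonneg.2 (hmax z)
  have hxs : f xstar - f xhat ≤ A + D / 4 := by
    have h3 := abs_le.1 (hconf xstar)
    have h4 := hA.2 ⟨xstar, rfl⟩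
    beta_reduce at h4
    linarith [h3.1]
  have hxz : f xhat - f z ≤ 2 * (g xhat - g z) + A + D / 4 := by
    have h3 := abs_le.1 (hconf z)
    have h4 := hA.2 ⟨z, rfl⟩
    beta_reduce at h4
    linarith [h3.2]
  set u := g xhat - g z
  set I := Real.log (1 + ψ z)
  set q := r ^ 2 * I with hq
  have hq0 : 0 ≤ q := by positivity
  have hpA : A ^ 2 ≤ (A + p * u) ^ 2 := by
    have := mul_nonneg hp.1 hg0
    gcongr
    linarith
  -- The left side keeps a factor p. It cancels against the p in p·I, which bounds u by the full
  -- information gain when there is feedback.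
  have hamgm : 4 * A * u * p ≤ (A + p * u) ^ 2 := by nlinarith [sq_nonneg (A - p * u)]
  have hrI : 0 ≤ p * I := mul_nonneg hp.1 hI0
  rcases lt_or_ge A (D / 4) with hlt | hge
  · obtain ⟨rfl, h3⟩ := h2 hlt
    refine ⟨?_, fun hp0 => ?_⟩
    · rw [sub_self, mul_zero, mul_zero]; positivity
    have hfz : f xhat - f z ≤ 4 / 3 * (2 * u + A) := by
      by_cases hz : z = xhat
      · rw [hz, sub_self]; positivity
      · have := hgap z hz
        linarith
    suffices h : D * (2 * u + A) ≤ 120 * q by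
      rw [sub_self, zero_add, mul_assoc, ← hq]
      nlinarith
    rcases hA0.eq_or_lt with h0 | hpos
    · rw [← h0] at h3 ⊢
      have h4 : (p * u) ^ 2 ≤ 0 := by simpa using h3
      have h5 : p * u = 0 := by nlinarith [sq_nonneg (p * u)]
      have h6 : u = 0 := by simpa [hp0.ne'] using h5
      rw [h6]
      simpa using hq0
    have h3' : D * (A + p * u) ^ 2 ≤ 80 * A * p * q := by
      calc D * (A + p * u) ^ 2 ≤ D * (80 * A * r ^ 2 / D * (p * I)) := by gcongr
        _ = _ := by rw [hq]; field_simp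
    have hu : D * u ≤ 20 * q := by
      have h4 : (4 * A * p) * (D * u) ≤ (4 * A * p) * (20 * q) := by
        have := mul_le_mul_of_nonneg_left hamgm hD.le
        linarith
      exact le_of_mul_le_mul_left h4 (by positivity)
    have hAq : D * A ≤ 80 * q := by
      have h4 : A * (D * A) ≤ A * (80 * q) := by
        have h5 := mul_le_mul_of_nonneg_left hpA hD.le
        have h6 : A * p * q ≤ A * q := by
          have : 0 ≤ A * q := by positivity
          nlinarith [hp.2]
        nlinarith
      exact le_of_mul_le_mul_left h4 hpos
    linarith
  -- Here D ≤ 4A: the error D/4 is absorbed into A, and D times a regret of order A becomes of order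
  -- A².
  · have hxs2 : f xstar - f xhat ≤ 2 * A := by linarith
    constructor
    · have h3 : D * (2 * (f xstar - f xhat)) ≤ D * (4 * A) :=
        mul_le_mul_of_nonneg_left (by linarith) hD.le
      have h4 : D * (4 * A) ≤ 4 * A * (4 * A) := by gcongr; linarith
      have h5 : 0 ≤ r ^ 2 * (p * I) := by positivity
      nlinarith
    · intro hp0
      have hApos : 0 < A := by linarith
      have hu : A * u ≤ 5 / 4 * q := by
        have h4 : (4 * p) * (A * u) ≤ (4 * p) * (5 / 4 * q) := by
          rw [hq]; linarith
        exact le_of_mul_le_mul_left h4 (by positivity)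
      have hAq : A ^ 2 ≤ 5 * q := by
        have h6 : p * q ≤ q := by nlinarith [hp.2]
        have h7 : 5 * r ^ 2 * (p * I) = 5 * (p * q) := by rw [hq]; ring
        linarith
      have h3 : D * ((f xstar - f xhat) + (f xstar - f z)) ≤ D * (6 * A + 2 * u) :=
        mul_le_mul_of_nonneg_left (by linarith) hD.le
      have h4 : D * (6 * A + 2 * u) ≤ 4 * A * (6 * A + 2 * u) := by gcongr; linarith
      rw [mul_assoc, ← hq]
      nlinarith

end Round

/-! ### Gaining a polynomial margin below δ. -/

section Deviation

open scoped InnerProductSpace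

lemma exp_neg_le {a : ℝ} (h0 : 0 ≤ a) (h1 : a ≤ 1) : Real.exp (-a) ≤ 1 - a / 2 := by
  rw [Real.exp_neg, inv_le_comm₀ (Real.exp_pos a) (by linarith), inv_le_iff_one_le_mul₀ (by linarith)]
  nlinarith [Real.add_one_le_exp a]

/-- To first order y exceeds T by a multiple of e. Dividing by κ, proportional to e, turns this into
an excess of order 1/N². The quadratic errors are harmless: T ≤ 2Ne gives T² ≤ κe/256, which is what
fixes the factor 1024. -/
lemma rescaled_slack {y T e N : ℝ} (he : 0 < e) (hN : 1 ≤ N) (hκ : 1024 * N ^ 2 * e ≤ 1)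
    (hT0 : 0 ≤ T) (hT : T / (1 + T) ≤ N * e) (hy : T / (1 + T) + e / 64 ≤ y) :
    1 / (2 ^ 19 * N ^ 2) ≤ y / (1024 * N ^ 2 * e + T) - T / (1024 * N ^ 2 * e) := by
  set κ := 1024 * N ^ 2 * e with hκdef
  have hκ0 : 0 < κ := by positivity
  have hNe : N * e ≤ 1 / 1024 := by
    have : N * e ≤ N ^ 2 * e := by gcongr; nlinarith
    linarith
  have hT2 : T ≤ 2 * (N * e) := by
    rw [div_le_iff₀ (by linarith)] at hT
    nlinarith
  have hTT : T ^ 2 ≤ κ * e / 256 := by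
    calc T ^ 2 ≤ (2 * (N * e)) ^ 2 := by gcongr
      _ = κ * e / 256 := by rw [hκdef]; ring
  have hTκ : T ≤ κ := by
    have : N * e ≤ N ^ 2 * e := by gcongr; nlinarith
    linarith
  have hyT : T + e / 128 ≤ y := by
    have h1 : T - T ^ 2 ≤ T / (1 + T) := by
      rw [le_div_iff₀ (by linarith)]
      nlinarith [pow_nonneg hT0 3]
    nlinarith
  have h1 : y / (κ + T) - T / κ = (κ * y - κ * T - T ^ 2) / (κ * (κ + T)) := by
    field_simp
    ring
  rw [h1]
  calc 1 / (2 ^ 19 * N ^ 2) = (κ * e / 256) / (κ * (κ + κ)) := by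
        rw [hκdef]; field_simp; ring
    _ ≤ (κ * e / 256) / (κ * (κ + T)) := by gcongr
    _ ≤ _ := by
        gcongr
        nlinarith

variable {E : Type*} [NormedAddCommGroup E] [InnerProductSpace ℝ E]

/-- Passing to a smaller regularizer turns a small deviation into a gain of the mixture. -/
lemma rescaled_mixture_gain {lam e N : ℝ} (hlam : 0 < lam) (he : 0 < e) (hN : 1 ≤ N)
    (hκ : 1024 * N ^ 2 * e ≤ 1) (φ : ℕ → E) (ξ : ℕ → ℝ) (t : ℕ)
    (hL : logVolume lam φ t ≤ N * e)
    (hQ : logVolume lam φ t + e / 64 ≤ noiseForm lam φ ξ t) :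
    1 / (2 ^ 19 * N ^ 2) ≤ noiseForm (1024 * N ^ 2 * e * lam) φ ξ t -
      logVolume (1024 * N ^ 2 * e * lam) φ t := by
  set κ := 1024 * N ^ 2 * e with hκdef
  have hκ0 : 0 < κ := by positivity
  have hc : 0 < κ * lam := by positivity
  set τ := ∑ s ∈ Finset.range t, ‖φ s‖ ^ 2 with hτ
  have hτ0 : 0 ≤ τ := Finset.sum_nonneg fun s _ => by positivity
  have h1 := le_logVolume hlam φ t
  have h2 := logVolume_le hc φ t
  have h3 : noiseForm lam φ ξ t ≤ _ := inner_resolvent_self_le hlam φ t (noiseSum φ ξ t)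
  have h4 : _ ≤ noiseForm (κ * lam) φ ξ t :=
    norm_sq_div_le_inner_resolvent_self hc φ t (noiseSum φ ξ t)
  rw [← hτ] at h1 h2 h4
  set s := ‖noiseSum φ ξ t‖ ^ 2
  have hT : τ / (lam + τ) = τ / lam / (1 + τ / lam) := by field_simp
  have h5 := rescaled_slack (y := s / lam) (T := τ / lam) he hN hκ (by positivity)
    (by linarith) (by linarith)
  rw [← hκdef] at h5
  have h6 : s / lam / (κ + τ / lam) = s / (κ * lam + τ) := by field_simp
  have h7 : τ / lam / κ = τ / (κ * lam) := by field_simp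
  rw [h6, h7] at h5
  linarith

variable [FiniteDimensional ℝ E] {Ω : Type*} {mΩ : MeasurableSpace Ω} {μ : Measure Ω}
  [IsProbabilityMeasure μ] {ℱ : Filtration ℕ mΩ} {𝒢 : ℕ → MeasurableSpace Ω}
  (h𝒢 : ∀ t, ℱ t ≤ 𝒢 t) (h𝒢' : ∀ t, 𝒢 t ≤ ℱ (t + 1))
  {φ : Ω → ℕ → E} (hφ : ∀ t, Measurable[𝒢 t, borel E] fun ω => φ ω t)
  {ξ : ℕ → Ω → ℝ} (hξ : ∀ t, Measurable[ℱ (t + 1)] (ξ t)) {v : ℝ}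
  (hsub : ∀ t, CondSubGaussian μ (𝒢 t) (ξ t) v)

include h𝒢 h𝒢' hφ hξ hsub

/-- The regularizer `c` and the noise scale `r` of the mixture are left free; they need not be those
of the algorithm. -/
lemma measure_le_exp_of_gain {c r x : ℝ} (hc : 0 < c) (hr : 0 < r) (hv : v ≤ r ^ 2) (n : ℕ)
    {A : Set Ω} (hA : ∀ ω ∈ A, ∃ t ≤ n,
      x ≤ noiseForm c (φ ω) (fun s => ξ s ω) t / r ^ 2 - logVolume c (φ ω) t) :
    μ.real A ≤ Real.exp (-(x / 2)) := by
  have h := mul_measure_exists_le_mixture h𝒢 h𝒢' hφ (ξ := fun t ω => ξ t ω / r)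
    (fun t => (hξ t).div_const r) (fun t => (hsub t).div_const hr hv) hc (Real.exp (x / 2)) n
  have hsubset : A ⊆ {ω | ∃ t ≤ n, Real.exp (x / 2) ≤
      mixture c (φ ω) (fun s => ξ s ω / r) t} := by
    intro ω hω
    obtain ⟨t, ht, hx⟩ := hA ω hω
    refine ⟨t, ht, Real.exp_le_exp.2 ?_⟩
    rw [noiseForm_div]
    linarith
  have h1 : ENNReal.ofReal (Real.exp (x / 2)) * μ A ≤ 1 :=
    (mul_le_mul_right (measure_mono hsubset) _).trans h
  rw [← ofReal_measureReal (s := A), ← ENNReal.ofReal_mul (Real.exp_pos _).le,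
    ← ENNReal.ofReal_one, ENNReal.ofReal_le_ofReal_iff zero_le_one] at h1
  rw [Real.exp_neg, ← one_div, le_div_iff₀ (Real.exp_pos _), mul_comm]
  exact h1

/-- The probability that the confidence bound fails by the margin `D` while it is still
informative leaves room below `δ`. -/
theorem measure_deviation_add_le (hφ2 : ∀ ω t, ‖φ ω t‖ ≤ 2) {rho D lam delta : ℝ}
    (hrho : 0 ≤ rho) (hv : v = rho ^ 2) (hD : 0 < D) (hlam : 1 ≤ lam) (hd0 : 0 < delta)
    (hd1 : delta < 1) {n : ℕ} (hn : 2 ≤ n) :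
    μ.real {ω | ∃ t ≤ n, rho ^ 2 * (logVolume lam (φ ω) t + 2 * Real.log (1 / delta)) + D ^ 2 / 64 <
        noiseForm lam (φ ω) (fun s => ξ s ω) t ∧
      rho ^ 2 * (logVolume lam (φ ω) t + 2 * Real.log (1 / delta)) ≤ n ^ 2 * D ^ 2} +
      (delta / n) ^ 40 ≤ delta := by
  have hlam0 : 0 < lam := by linarith
  set l := Real.log (1 / delta) with hl
  have hl1 : 1 - delta ≤ l := by
    have h := Real.log_le_sub_one_of_pos hd0
    rw [hl, one_div, Real.log_inv]
    linarith
  have hl0 : 0 < l := by linarith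
  have hexpl : Real.exp (-l) = delta := by
    rw [hl, one_div, Real.log_inv, neg_neg, Real.exp_log hd0]
  have hnR : (2 : ℝ) ≤ n := by exact_mod_cast hn
  set A := {ω | ∃ t ≤ n, rho ^ 2 * (logVolume lam (φ ω) t + 2 * l) + D ^ 2 / 64 <
        noiseForm lam (φ ω) (fun s => ξ s ω) t ∧
      rho ^ 2 * (logVolume lam (φ ω) t + 2 * l) ≤ n ^ 2 * D ^ 2} with hA
  -- As n ≥ 2, constants 2^k are absorbed into powers of n. The exponent 40 leaves room for the
  -- largest case, 29 + 6.
  have hpow : ∀ j k : ℕ, j ≤ 40 → k + j ≤ 40 → (1 / (n : ℝ)) ^ 40 ≤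
      1 / (2 ^ k * (n : ℝ) ^ j) := by
    intro j k hj hk
    rw [one_div_pow]
    apply one_div_le_one_div_of_le (by positivity)
    calc (2 : ℝ) ^ k * (n : ℝ) ^ j ≤ (n : ℝ) ^ k * (n : ℝ) ^ j := by gcongr
      _ = (n : ℝ) ^ (k + j) := (pow_add _ _ _).symm
      _ ≤ (n : ℝ) ^ 40 := by gcongr; linarith
  have hdn : (delta / n) ^ 40 ≤ delta * (1 / (n : ℝ)) ^ 40 := by
    rw [div_eq_mul_one_div, mul_pow]
    gcongr
    exact pow_le_of_le_one hd0.le hd1.le (by norm_num)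
  have of_factor : ∀ a, 1 / (2 ^ 28 * (n : ℝ) ^ 6) ≤ a →
      μ.real A ≤ delta * Real.exp (-a) → μ.real A + (delta / n) ^ 40 ≤ delta := by
    intro a ha h
    have h1 : Real.exp (-a) ≤ 1 - 1 / (2 ^ 28 * (n : ℝ) ^ 6) / 2 := by
      refine (Real.exp_le_exp.2 (neg_le_neg ha)).trans (exp_neg_le (by positivity) ?_)
      rw [div_le_one (by positivity)]
      have : (1 : ℝ) ≤ (n : ℝ) ^ 6 := one_le_pow₀ (by linarith)
      linarith
    have h2 := hpow 6 29 (by norm_num) (by norm_num)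
    have h3 : 1 / (2 ^ 28 * (n : ℝ) ^ 6) / 2 = 1 / (2 ^ 29 * (n : ℝ) ^ 6) := by
      field_simp
    rw [h3] at h1
    have h4 := mul_le_mul_of_nonneg_left h1 hd0.le
    have h5 := mul_le_mul_of_nonneg_left h2 hd0.le
    linarith
  rcases hrho.eq_or_lt with hr0 | hrpos
  · refine of_factor (1 / 2) ?_ ?_
    · rw [div_le_div_iff₀ (by positivity) (by norm_num)]
      have : (1 : ℝ) ≤ (n : ℝ) ^ 6 := one_le_pow₀ (by linarith)
      linarith
    -- With zero variance proxy every r > 0 is admissible. Here r² = D²/w is so small that the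
    -- margin D²/64 alone exceeds the log-determinant, at most 4n, by 2l + 1.
    set w : ℝ := 64 * (4 * n + 2 * l + 1) with hw
    have hw0 : 0 < w := by positivity
    have hbound := measure_le_exp_of_gain h𝒢 h𝒢' hφ hξ hsub (c := lam) (r := √(D ^ 2 / w))
      (x := 2 * l + 1) hlam0 (Real.sqrt_pos.2 (by positivity))
      (by rw [hv, ← hr0, zero_pow two_ne_zero]; positivity) n (A := A) (by
        rintro ω ⟨t, ht, h1, -⟩
        refine ⟨t, ht, ?_⟩
        rw [Real.sq_sqrt (by positivity)]
        have h2 : logVolume lam (φ ω) t ≤ 4 * n := by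
          refine (logVolume_le hlam0 (φ ω) t).trans ?_
          rw [div_le_iff₀ hlam0]
          calc ∑ s ∈ Finset.range t, ‖φ ω s‖ ^ 2 ≤ ∑ s ∈ Finset.range t, (4 : ℝ) := by
                refine Finset.sum_le_sum fun s _ => ?_
                nlinarith [hφ2 ω s, norm_nonneg (φ ω s)]
            _ = 4 * (t : ℝ) := by simp [mul_comm]
            _ ≤ 4 * n := by gcongr
            _ ≤ 4 * n * lam := by nlinarith
        rw [← hr0] at h1
        have h3 : D ^ 2 / 64 / (D ^ 2 / w) = 4 * n + 2 * l + 1 := by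
          rw [hw]; field_simp
        have h4 : D ^ 2 / 64 / (D ^ 2 / w) ≤
            noiseForm lam (φ ω) (fun s => ξ s ω) t / (D ^ 2 / w) := by
          gcongr
          linarith
        linarith)
    refine hbound.trans_eq ?_
    rw [← hexpl, ← Real.exp_add]
    congr 1
    ring
  set e := D ^ 2 / rho ^ 2 with he
  have he0 : 0 < e := by positivity
  have hDe : D ^ 2 = e * rho ^ 2 := by rw [he]; field_simp
  have hmem : ∀ ω ∈ A, ∃ t ≤ n, logVolume lam (φ ω) t + 2 * l + e / 64 ≤
      noiseForm lam (φ ω) (fun s => ξ s ω) t / rho ^ 2 ∧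
      logVolume lam (φ ω) t + 2 * l ≤ n ^ 2 * e := by
    rintro ω ⟨t, ht, h1, h2⟩
    have hr2 : 0 < rho ^ 2 := by positivity
    refine ⟨t, ht, ?_, ?_⟩
    · rw [le_div_iff₀ hr2]
      rw [hDe] at h1
      linarith
    · rw [hDe] at h2
      have : rho ^ 2 * (logVolume lam (φ ω) t + 2 * l) ≤ rho ^ 2 * (n ^ 2 * e) := by linarith
      exact le_of_mul_le_mul_left this hr2
  have caseA : μ.real A ≤ delta * Real.exp (-(e / 128)) := by
    have hbound := measure_le_exp_of_gain h𝒢 h𝒢' hφ hξ hsub (c := lam) (r := rho)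
      (x := 2 * l + e / 64) hlam0 hrpos hv.le n (A := A) (by
        intro ω hω
        obtain ⟨t, ht, h1, -⟩ := hmem ω hω
        exact ⟨t, ht, by linarith⟩)
    refine hbound.trans_eq ?_
    rw [← hexpl, ← Real.exp_add]
    congr 1
    ring
  -- If e is not tiny, the margin e/64 in the exponent already saves enough. If e is tiny, 2l ≤ n²e
  -- forces δ close to 1 or the event to be empty.
  by_cases hbig : 1 / (2 ^ 21 * (n : ℝ) ^ 6) ≤ e
  · refine of_factor _ ?_ caseA
    have h1 : 1 / (2 ^ 28 * (n : ℝ) ^ 6) = 1 / (2 ^ 21 * (n : ℝ) ^ 6) / 128 := by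
      field_simp
      norm_num
    rw [h1]
    gcongr
  push Not at hbig
  by_cases hδ : 1 / (2 ^ 22 * (n : ℝ) ^ 4) ≤ 1 - delta
  · have hempty : A = ∅ := by
      refine Set.eq_empty_of_forall_notMem fun ω hω => ?_
      obtain ⟨t, -, -, h2⟩ := hmem ω hω
      have h3 := logVolume_nonneg hlam0 (φ ω) t
      have h4 : (n : ℝ) ^ 2 * e < n ^ 2 * (1 / (2 ^ 21 * (n : ℝ) ^ 6)) := by gcongr
      have h5 : (n : ℝ) ^ 2 * (1 / (2 ^ 21 * (n : ℝ) ^ 6)) = 2 * (1 / (2 ^ 22 * (n : ℝ) ^ 4)) := by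
        field_simp
      linarith
    rw [hempty, measureReal_empty, zero_add]
    refine hdn.trans (mul_le_of_le_one_right hd0.le ?_)
    exact pow_le_one₀ (by positivity) (by rw [div_le_one (by linarith)]; linarith)
  push Not at hδ
  have hN : (1 : ℝ) ≤ (n : ℝ) ^ 2 := one_le_pow₀ (by linarith)
  have hκ : 1024 * ((n : ℝ) ^ 2) ^ 2 * e ≤ 1 := by
    calc 1024 * ((n : ℝ) ^ 2) ^ 2 * e
        ≤ 1024 * ((n : ℝ) ^ 2) ^ 2 * (1 / (2 ^ 21 * (n : ℝ) ^ 6)) := by gcongr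
      _ = 1 / (2 ^ 11 * (n : ℝ) ^ 2) := by field_simp; norm_num
      _ ≤ 1 := by rw [div_le_one (by positivity)]; linarith
  -- With δ within 1/(2²²n⁴) of 1, it suffices to bound the probability away from 1. The mixture
  -- with the much smaller regularizer κλ does this, with N = n² in the rescaling.
  have caseB := measure_le_exp_of_gain h𝒢 h𝒢' hφ hξ hsub
    (c := 1024 * ((n : ℝ) ^ 2) ^ 2 * e * lam) (r := rho)
    (x := 1 / (2 ^ 19 * ((n : ℝ) ^ 2) ^ 2)) (by positivity) hrpos hv.le n (A := A) (by
      intro ω hω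
      obtain ⟨t, ht, h1, h2⟩ := hmem ω hω
      refine ⟨t, ht, ?_⟩
      rw [← noiseForm_div] at h1 ⊢
      exact rescaled_mixture_gain hlam0 he0 hN hκ (φ ω) _ t (by linarith) (by linarith))
  have h1 : 1 / (2 ^ 19 * ((n : ℝ) ^ 2) ^ 2) / 2 = 1 / (2 ^ 20 * (n : ℝ) ^ 4) := by
    field_simp
  rw [h1] at caseB
  have h2 : Real.exp (-(1 / (2 ^ 20 * (n : ℝ) ^ 4))) ≤ 1 - 1 / (2 ^ 20 * (n : ℝ) ^ 4) / 2 := by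
    refine exp_neg_le (by positivity) ?_
    rw [div_le_one (by positivity)]
    have : (1 : ℝ) ≤ (n : ℝ) ^ 4 := one_le_pow₀ (by linarith)
    linarith
  have h3 : 1 / (2 ^ 20 * (n : ℝ) ^ 4) / 2 = 2 * (1 / (2 ^ 22 * (n : ℝ) ^ 4)) := by
    field_simp
  have h4 := hpow 4 22 (by norm_num) (by norm_num)
  have h5 : (delta / n) ^ 40 ≤ (1 / (n : ℝ)) ^ 40 := by
    gcongr
  linarith

end Deviation

/-! ### Confidence coefficients along a sample path. -/

section Pathwise

open scoped InnerProductSpace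

variable {X : Type*} {H : Type*} [NormedAddCommGroup H] [InnerProductSpace ℝ H] [CompleteSpace H]
  [RKHS ℝ H X ℝ]

lemma betaSqrt_eq {lam : ℝ} (hlam : 0 < lam) (rho B delta : ℝ) (x1 x2 : ℕ → X) (t : ℕ) :
    betaSqrt H lam rho B delta x1 x2 t =
      rho * √(logVolume lam (pairFeature H x1 x2) t + 2 * Real.log (1 / delta)) + √lam * B := by
  rw [betaSqrt, log_det_eq x1 x2 t hlam]

lemma betaSqrt_nonneg {lam rho B : ℝ} (hrho : 0 ≤ rho) (hB : 0 ≤ B) (delta : ℝ)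
    (x1 x2 : ℕ → X) (t : ℕ) : 0 ≤ betaSqrt H lam rho B delta x1 x2 t := by
  unfold betaSqrt
  positivity

lemma betaSqrt_mono {lam rho : ℝ} (hlam : 0 < lam) (hrho : 0 ≤ rho) (B delta : ℝ)
    (x1 x2 : ℕ → X) : Monotone (betaSqrt H lam rho B delta x1 x2) := by
  intro s t hst
  rw [betaSqrt_eq hlam, betaSqrt_eq hlam]
  have := logVolume_mono hlam (pairFeature H x1 x2) hst
  gcongr

lemma infoGain_nonneg (x1 x2 : ℕ → X) (t : ℕ) {lam : ℝ} (hlam : 0 < lam) (x z : X) :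
    0 ≤ infoGain H lam x1 x2 t x z :=
  Real.log_nonneg (by linarith [psi_nonneg (H := H) x1 x2 t hlam x z])

lemma infoGain_le (hk : ∀ x : X, kern H x x ≤ 1) (x1 x2 : ℕ → X) (t : ℕ) {lam : ℝ}
    (hlam : 0 < lam) (x z : X) : infoGain H lam x1 x2 t x z ≤ 2 := by
  have h0 := psi_nonneg (H := H) x1 x2 t hlam x z
  have h4 := psi_le hk x1 x2 t hlam x z
  rw [infoGain, Real.log_le_iff_le_exp (by linarith)]
  have h1 : Real.exp 2 = Real.exp 1 * Real.exp 1 := by rw [← Real.exp_add]; norm_num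
  have h2 := Real.exp_one_gt_d9
  nlinarith

lemma isGreatest_plausibleRegret [Finite X] (lam rho B delta : ℝ) (x1 x2 : ℕ → X) (t : ℕ)
    (fhat : H) (xhat : X) :
    IsGreatest (Set.range fun x => fhat x - fhat xhat +
      betaSqrt H lam rho B delta x1 x2 t * √(psi H lam x1 x2 t xhat x))
      (plausibleRegret lam rho B delta x1 x2 t fhat xhat) := by
  have : Nonempty X := ⟨xhat⟩
  constructor
  · obtain ⟨x, hx⟩ := exists_eq_ciSup_of_finite (f := fun x => fhat x - fhat xhat +
      betaSqrt H lam rho B delta x1 x2 t * √(psi H lam x1 x2 t xhat x))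
    exact ⟨x, hx⟩
  · rintro _ ⟨x, rfl⟩
    exact le_ciSup (f := fun x => fhat x - fhat xhat +
      betaSqrt H lam rho B delta x1 x2 t * √(psi H lam x1 x2 t xhat x))
      (Set.finite_range _).bddAbove x

/-- If the confidence bound is violated by a margin, the aggregated noise is large. -/
lemma IsLeastSquares.noiseForm_gt (hk : ∀ x : X, kern H x x ≤ 1) {lam rho B delta D : ℝ}
    (hlam : 1 ≤ lam) (hrho : 0 ≤ rho) (hd0 : 0 < delta) (hd1 : delta < 1) (hD : 0 < D)
    {x1 x2 : ℕ → X} {d ξ : ℕ → ℝ} {t : ℕ} {f g : H} (hf : ‖f‖ ≤ B)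
    (hg : IsLeastSquares lam x1 x2 d t g)
    (hd : ∀ s < t, d s • pairFeature H x1 x2 s =
      (f (x1 s) - f (x2 s) + ξ s) • pairFeature H x1 x2 s) {x z : X}
    (hviol : betaSqrt H lam rho B delta x1 x2 t * √(psi H lam x1 x2 t x z) + D / 4 <
      |(g x - f x) - (g z - f z)|) :
    rho ^ 2 * (logVolume lam (pairFeature H x1 x2) t + 2 * Real.log (1 / delta)) + D ^ 2 / 64 <
      noiseForm lam (pairFeature H x1 x2) ξ t := by
  have hlam0 : 0 < lam := by linarith
  have hB : 0 ≤ B := (norm_nonneg f).trans hf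
  have h1 := hviol.trans_le (hg.abs_error_le hlam0 hf hd x z)
  change _ < (√(noiseForm lam (pairFeature H x1 x2) ξ t) + _) * _ at h1
  rw [betaSqrt_eq hlam0] at h1
  have hl : 0 < Real.log (1 / delta) := Real.log_pos (by rw [lt_div_iff₀ hd0]; linarith)
  have hL := logVolume_nonneg hlam0 (pairFeature H x1 x2) t
  have hψ0 := psi_nonneg (H := H) x1 x2 t hlam0 x z
  have hψ4 := psi_le hk x1 x2 t hlam0 x z
  set Q := noiseForm lam (pairFeature H x1 x2) ξ t
  have hsqL : √(logVolume lam (pairFeature H x1 x2) t + 2 * Real.log (1 / delta)) ^ 2 =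
    logVolume lam (pairFeature H x1 x2) t + 2 * Real.log (1 / delta) := Real.sq_sqrt (by positivity)
  rw [← hsqL, ← mul_pow]
  set G := rho * √(logVolume lam (pairFeature H x1 x2) t + 2 * Real.log (1 / delta)) with hG
  have hG0 : 0 ≤ G := by positivity
  set s := √(psi H lam x1 x2 t x z / lam) with hs
  have hs0 : 0 ≤ s := Real.sqrt_nonneg _
  have hsle : s ≤ √(psi H lam x1 x2 t x z) :=
    Real.sqrt_le_sqrt (div_le_self hψ0 hlam)
  have hs2 : s ≤ 2 := by
    refine hsle.trans (Real.sqrt_le_iff.2 ⟨by norm_num, by linarith⟩)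
  have hB' : 0 ≤ √lam * B := by positivity
  have h2 : (G + √lam * B) * s ≤ (G + √lam * B) * √(psi H lam x1 x2 t x z) := by gcongr
  -- The bias terms cancel, using ψ/λ ≤ ψ from λ ≥ 1. Since s ≤ 2, a violation by D/4 makes √Q
  -- exceed G by D/8, whence D²/64 after squaring.
  have h3 : D / 4 < (√Q - G) * s := by linarith
  have h4 : G + D / 8 < √Q := by
    by_contra hcon
    push Not at hcon
    have : (√Q - G) * s ≤ D / 8 * s := by gcongr; linarith
    nlinarith
  have h5 : (G + D / 8) ^ 2 < Q := (Real.lt_sqrt (by positivity)).1 h4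
  nlinarith [mul_nonneg hG0 hD.le]

end Pathwise

/-! ### Runs of the algorithm and the final union bound. -/

section Run

namespace Interaction

lemma x2_of_true {Ω X H : Type*} {P : Interaction Ω X H} {ω : Ω} {t : ℕ} (h : P.b t ω = true) : P.x2 ω t = P.z t ω := by
  simp [x2, h]

lemma x2_of_false {Ω X H : Type*} {P : Interaction Ω X H} {ω : Ω} {t : ℕ} (h : P.b t ω = false) :
    P.x2 ω t = P.xhat t ω := by
  simp [x2, h]

end Interaction

variable {X : Type*} {H : Type*} [NormedAddCommGroup H] [InnerProductSpace ℝ H] [CompleteSpace H]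
  [RKHS ℝ H X ℝ] {Ω : Type*} {mΩ : MeasurableSpace Ω} {μ : Measure Ω} {ℱ : Filtration ℕ mΩ}
  {f : H} {lam rho B delta : ℝ} {P : Interaction Ω X H}

/-- Without feedback both actions agree and the feature vanishes, so the placeholder value may be
treated as a genuine noisy observation. -/
lemma Interaction.feedback_smul (f : H) (ω : Ω) (s : ℕ) :
    P.feedback f ω s • pairFeature H (P.x1 ω) (P.x2 ω) s =
      (f (P.x1 ω s) - f (P.x2 ω s) + P.noise s ω) • pairFeature H (P.x1 ω) (P.x2 ω) s := by
  cases h : P.b s ω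
  · rw [pairFeature, Interaction.x2_of_false h, Interaction.x1, sub_self, smul_zero, smul_zero]
  · simp [Interaction.feedback, h]

lemma totalGain_eq (lam : ℝ) (P : Interaction Ω X H) (ω : Ω) (n : ℕ) :
    totalGain H lam (P.x1 ω) (P.x2 ω) n = ∑ t ∈ Finset.range n, bit (P.b t ω) *
      infoGain H lam (P.x1 ω) (P.x2 ω) t (P.xhat t ω) (P.z t ω) := by
  refine Finset.sum_congr rfl fun t _ => ?_
  cases h : P.b t ω
  · rw [Interaction.x2_of_false h, Interaction.x1, infoGain, psi_self]
    simp [bit]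
  · rw [Interaction.x2_of_true h, Interaction.x1]
    simp [bit]

lemma duelRegret_le (hk : ∀ x : X, kern H x x ≤ 1) (hf : ‖f‖ ≤ B) (xstar : X)
    (P : Interaction Ω X H) (n : ℕ) (ω : Ω) : duelRegret f xstar P n ω ≤ 4 * n * B := by
  calc duelRegret f xstar P n ω ≤ ∑ _t ∈ Finset.range n, 4 * B := by
        refine Finset.sum_le_sum fun t _ => ?_
        have h1 := sub_apply_le hk f xstar (P.x1 ω t)
        have h2 := sub_apply_le hk f xstar (P.x2 ω t)
        rw [gap, gap]
        linarith
    _ = 4 * n * B := by simp; ring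

/-- The regret bound on a sample path where the estimates are accurate up to a quarter of the
gap. -/
lemma IsRun.duelRegret_le_of_accurate [Finite X] (hrun : IsRun μ ℱ f lam rho B delta P)
    (hk : ∀ x : X, kern H x x ≤ 1) (hB : 0 ≤ B) (hlam : 0 < lam) (hrho : 0 ≤ rho)
    {xstar : X} {D : ℝ} (hD : 0 < D) (hgap : ∀ x, x ≠ xstar → D ≤ gap f xstar x) {n : ℕ} {ω : Ω}
    (hacc : ∀ t < n, ∀ x z, |(P.fhat t ω x - f x) - (P.fhat t ω z - f z)| ≤
      betaSqrt H lam rho B delta (P.x1 ω) (P.x2 ω) t * √(psi H lam (P.x1 ω) (P.x2 ω) t x z) + D / 4)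
    (hpos : ∀ t < n, P.b t ω = true → 0 < P.p t ω) :
    D * duelRegret f xstar P n ω ≤ 160 * beta H lam rho B delta (P.x1 ω) (P.x2 ω) (n - 1) *
      (∑ t ∈ Finset.range n, bit (P.b t ω) *
          infoGain H lam (P.x1 ω) (P.x2 ω) t (P.xhat t ω) (P.z t ω) +
        ∑ t ∈ Finset.range n, P.p t ω *
          infoGain H lam (P.x1 ω) (P.x2 ω) t (P.xhat t ω) (P.z t ω)) := by
  rw [duelRegret, Finset.mul_sum, ← Finset.sum_add_distrib, Finset.mul_sum]
  refine Finset.sum_le_sum fun t ht => ?_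
  have htn := Finset.mem_range.1 ht
  set I := infoGain H lam (P.x1 ω) (P.x2 ω) t (P.xhat t ω) (P.z t ω) with hI
  have hI0 : 0 ≤ I := infoGain_nonneg _ _ _ hlam _ _
  have hp0 := (hrun.p_mem t ω).1
  have hbs0 := betaSqrt_nonneg (H := H) (lam := lam) hrho hB delta (P.x1 ω) (P.x2 ω) t
  have hmono : betaSqrt H lam rho B delta (P.x1 ω) (P.x2 ω) t ^ 2 ≤
      beta H lam rho B delta (P.x1 ω) (P.x2 ω) (n - 1) := by
    rw [beta]
    have := betaSqrt_mono (H := H) hlam hrho B delta (P.x1 ω) (P.x2 ω) (Nat.le_sub_one_of_lt htn)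
    gcongr
  set r := betaSqrt H lam rho B delta (P.x1 ω) (P.x2 ω) t
  set β := beta H lam rho B delta (P.x1 ω) (P.x2 ω) (n - 1)
  obtain ⟨h1, h2⟩ := round_regret_le (f := f) (g := P.fhat t ω) (xstar := xstar)
    (xhat := P.xhat t ω) (z := P.z t ω) (r := r) (p := P.p t ω)
    (ψ := fun x => psi H lam (P.x1 ω) (P.x2 ω) t (P.xhat t ω) x)
    (fun x => psi_nonneg _ _ _ hlam _ x) (fun x => psi_le hk _ _ _ hlam _ x) (psi_self _ _ _ _ _)
    hD hgap (hrun.xhat_spec t ω)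
    (fun x => by rw [abs_sub_comm]; exact hacc t htn (P.xhat t ω) x)
    (isGreatest_plausibleRegret lam rho B delta (P.x1 ω) (P.x2 ω) t (P.fhat t ω) (P.xhat t ω))
    (hrun.p_mem t ω) (fun z' p' hp' => hrun.zp_spec t ω z' p' hp')
  change _ ≤ 160 * r ^ 2 * (P.p t ω * I) at h1
  change _ → _ ≤ 160 * r ^ 2 * I at h2
  have hpI : 0 ≤ P.p t ω * I := mul_nonneg hp0 hI0
  rw [gap, gap, show P.x1 ω t = P.xhat t ω from rfl]
  cases hb : P.b t ω
  · rw [Interaction.x2_of_false hb]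
    simp only [bit, Bool.false_eq_true, if_false, zero_mul, zero_add]
    rw [← two_mul]
    refine h1.trans ?_
    gcongr
  · rw [Interaction.x2_of_true hb]
    simp only [bit, if_true, one_mul]
    refine (h2 (hpos t htn hb)).trans ?_
    calc 160 * r ^ 2 * I ≤ 160 * β * I := by gcongr
      _ ≤ 160 * β * (I + P.p t ω * I) := by
        have : 0 ≤ β := (sq_nonneg r).trans hmono
        gcongr
        linarith

/-- If the regret bound fails, the confidence coefficient is small compared with the gap. -/
lemma coefficient_le_of_regret_gt (hk : ∀ x : X, kern H x x ≤ 1) (hf : ‖f‖ ≤ B) {xstar x : X}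
    {D C : ℝ} (hD : 0 < D) (hC : 8 ≤ C) (hDx : D = gap f xstar x) (hlam : 1 ≤ lam)
    (hrho : 0 ≤ rho) (hd0 : 0 < delta) (hd1 : delta < 1) {n : ℕ} (hn : 2 ≤ n) {ω : Ω}
    (hfail : C * D⁻¹ * beta H lam rho B delta (P.x1 ω) (P.x2 ω) (n - 1) *
      (totalGain H lam (P.x1 ω) (P.x2 ω) n + Real.log (n / delta)) < duelRegret f xstar P n ω)
    {t : ℕ} (ht : t < n) :
    rho ^ 2 * (logVolume lam (pairFeature H (P.x1 ω) (P.x2 ω)) t + 2 * Real.log (1 / delta)) ≤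
      n ^ 2 * D ^ 2 := by
  have hlam0 : 0 < lam := by linarith
  have hDB : D ≤ 2 * B := by
    have := sub_apply_le hk f xstar x
    rw [hDx, gap]
    linarith
  have hB : 0 < B := by linarith
  have hnR : (2 : ℝ) ≤ n := by exact_mod_cast hn
  have hl : 0 < Real.log (1 / delta) := Real.log_pos (by rw [lt_div_iff₀ hd0]; linarith)
  have hlog : 1 / 2 ≤ Real.log (n / delta) := by
    have h1 : (2 : ℝ) ≤ n / delta := by
      rw [le_div_iff₀ hd0]
      nlinarith
    have h2 := Real.log_le_log (by norm_num) h1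
    have h3 := Real.log_two_gt_d9
    linarith
  have hγ : 0 ≤ totalGain H lam (P.x1 ω) (P.x2 ω) n :=
    Finset.sum_nonneg fun s _ => infoGain_nonneg _ _ _ hlam0 _ _
  have hL := logVolume_nonneg hlam0 (pairFeature H (P.x1 ω) (P.x2 ω)) (n - 1)
  have hLt := logVolume_mono hlam0 (pairFeature H (P.x1 ω) (P.x2 ω)) (Nat.le_sub_one_of_lt ht)
  have hbeta := betaSqrt_eq (H := H) hlam0 rho B delta (P.x1 ω) (P.x2 ω) (n - 1)
  set L := logVolume lam (pairFeature H (P.x1 ω) (P.x2 ω)) (n - 1)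
  set β := beta H lam rho B delta (P.x1 ω) (P.x2 ω) (n - 1) with hβ
  rw [beta, hbeta] at hβ
  have hG0 : 0 ≤ rho * √(L + 2 * Real.log (1 / delta)) := by positivity
  have hlB : B ≤ √lam * B := le_mul_of_one_le_left hB.le (Real.one_le_sqrt.2 hlam)
  have hβB : B ^ 2 ≤ β := by
    rw [hβ]
    gcongr
    linarith
  have hβG : rho ^ 2 * (L + 2 * Real.log (1 / delta)) ≤ β := by
    rw [hβ]
    calc rho ^ 2 * (L + 2 * Real.log (1 / delta)) =
          (rho * √(L + 2 * Real.log (1 / delta))) ^ 2 := by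
          rw [mul_pow, Real.sq_sqrt (by positivity)]
      _ ≤ _ := by gcongr; linarith
  have hβ0 : 0 ≤ β := (sq_nonneg B).trans hβB
  have h1 := hfail.trans_le (duelRegret_le hk hf xstar P n ω)
  have h2 : 8 * D⁻¹ * β * (1 / 2) ≤ C * D⁻¹ * β *
      (totalGain H lam (P.x1 ω) (P.x2 ω) n + Real.log (n / delta)) := by
    gcongr
    linarith
  -- Failure against the trivial bound 4nB, with log(n/δ) ≥ 1/2 and C ≥ 8. Combined with β ≥ B² it
  -- gives B ≤ nD, and hence β ≤ n²D².
  have h3 : β ≤ n * B * D := by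
    have h4 : 8 * D⁻¹ * β * (1 / 2) = 4 * (β / D) := by field_simp; ring
    have h5 : β / D ≤ n * B := by linarith
    rwa [div_le_iff₀ hD] at h5
  have h4 : B ≤ n * D := by
    have : B * B ≤ B * (n * D) := by nlinarith
    exact le_of_mul_le_mul_left this hB
  calc rho ^ 2 * (logVolume lam (pairFeature H (P.x1 ω) (P.x2 ω)) t + 2 * Real.log (1 / delta))
      ≤ rho ^ 2 * (L + 2 * Real.log (1 / delta)) := by gcongr
    _ ≤ n * B * D := hβG.trans h3
    _ ≤ n * (n * D) * D := by gcongr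
    _ = n ^ 2 * D ^ 2 := by ring

lemma measurable_comp_feature {m : MeasurableSpace Ω} {x : Ω → X} (hx : Measurable[m, ⊤] x) :
    Measurable[m, borel H] fun ω => feature H (x ω) :=
  (@measurable_from_top X H (borel H) (feature H)).comp hx

lemma IsRun.measurable_pairFeature [FiniteDimensional ℝ H]
    (hrun : IsRun μ ℱ f lam rho B delta P) (t : ℕ) :
    Measurable[ℱ t ⊔ MeasurableSpace.comap (P.b t) ⊤, borel H]
      fun ω => pairFeature H (P.x1 ω) (P.x2 ω) t := by
  borelize H
  have hprop : ProperSpace H := FiniteDimensional.proper ℝ H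
  have hset : MeasurableSet[ℱ t ⊔ MeasurableSpace.comap (P.b t) ⊤] {ω | P.b t ω = true} :=
    (le_sup_right : MeasurableSpace.comap (P.b t) ⊤ ≤ _) _ ⟨{true}, trivial, rfl⟩
  have hx : Measurable[ℱ t ⊔ MeasurableSpace.comap (P.b t) ⊤] fun ω => feature H (P.xhat t ω) :=
    measurable_comp_feature ((hrun.xhat_meas t).mono le_sup_left le_rfl)
  have hz : Measurable[ℱ t ⊔ MeasurableSpace.comap (P.b t) ⊤] fun ω => feature H (P.z t ω) :=
    measurable_comp_feature ((hrun.z_meas t).mono le_sup_left le_rfl)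
  have heq : (fun ω => pairFeature H (P.x1 ω) (P.x2 ω) t) = fun ω =>
      if P.b t ω = true then feature H (P.xhat t ω) - feature H (P.z t ω) else 0 := by
    ext1 ω
    cases h : P.b t ω
    · rw [pairFeature, Interaction.x2_of_false h]; simp [Interaction.x1]
    · rw [pairFeature, Interaction.x2_of_true h]; simp [Interaction.x1]
  rw [heq]
  exact Measurable.ite hset (hx.sub hz) measurable_const

lemma IsRun.sup_comap_le (hrun : IsRun μ ℱ f lam rho B delta P) (t : ℕ) :
    ℱ t ⊔ MeasurableSpace.comap (P.b t) ⊤ ≤ ℱ (t + 1) :=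
  sup_le (ℱ.mono (Nat.le_succ t)) (hrun.b_meas t).comap_le

lemma IsRun.measurable_infoGain [FiniteDimensional ℝ H]
    (hrun : IsRun μ ℱ f lam rho B delta P) (hlam : 0 < lam) (t : ℕ) :
    Measurable[ℱ t] fun ω =>
      infoGain H lam (P.x1 ω) (P.x2 ω) t (P.xhat t ω) (P.z t ω) := by
  borelize H
  have hprop : ProperSpace H := FiniteDimensional.proper ℝ H
  have hu : Measurable[ℱ t] fun ω => feature H (P.xhat t ω) - feature H (P.z t ω) :=
    (measurable_comp_feature (hrun.xhat_meas t)).sub (measurable_comp_feature (hrun.z_meas t))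
  have hφ : ∀ s < t, Measurable[ℱ t] fun ω => pairFeature H (P.x1 ω) (P.x2 ω) s := fun s hs =>
    (hrun.measurable_pairFeature s).mono ((hrun.sup_comap_le s).trans (ℱ.mono hs)) le_rfl
  simp only [infoGain, psi_eq _ _ _ hlam]
  exact (((measurable_inner_resolvent lam hφ hu hu).const_mul lam).const_add 1).log

-- A function in `H` is determined by its values on the finite set `X`. Finite dimension makes `H`
-- second countable, as the Borel measurability arguments require.
omit [CompleteSpace H] in
lemma finiteDimensional_of_finite [Finite X] : FiniteDimensional ℝ H :=
  Module.Finite.of_injective (RKHS.coeCLM ℝ : H →L[ℝ] X → ℝ).toLinearMap RKHS.coeCLM_injective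

/-- The estimates of the first `n` rounds are accurate up to `D / 4`, with the confidence
coefficient of the algorithm. -/
def AccurateBefore (f : H) (lam rho B delta D : ℝ) (P : Interaction Ω X H) (n : ℕ) (ω : Ω) : Prop :=
  ∀ t < n, ∀ x z, |(P.fhat t ω x - f x) - (P.fhat t ω z - f z)| ≤
    betaSqrt H lam rho B delta (P.x1 ω) (P.x2 ω) t * √(psi H lam (P.x1 ω) (P.x2 ω) t x z) + D / 4

/-- The event that the estimates are inaccurate and the regret bound fails has probability less
than `δ`, by a margin that is polynomial in `δ / n`. -/
lemma IsRun.measure_inaccurate_add_le [Finite X] [IsProbabilityMeasure μ]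
    (hrun : IsRun μ ℱ f lam rho B delta P) (hnoise : HasSubGaussianNoise μ ℱ rho P)
    (hk : ∀ x : X, kern H x x ≤ 1) (hf : ‖f‖ ≤ B) {xstar x : X} {D C : ℝ} (hD : 0 < D)
    (hC : 8 ≤ C) (hDx : D = gap f xstar x) (hlam : 1 ≤ lam) (hrho : 0 ≤ rho) (hd0 : 0 < delta)
    (hd1 : delta < 1) {n : ℕ} (hn : 1 ≤ n) :
    μ.real {ω | ¬ AccurateBefore f lam rho B delta D P n ω ∧
      C * D⁻¹ * beta H lam rho B delta (P.x1 ω) (P.x2 ω) (n - 1) *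
        (totalGain H lam (P.x1 ω) (P.x2 ω) n + Real.log (n / delta)) < duelRegret f xstar P n ω} +
      (delta / n) ^ 40 ≤ delta := by
  have hfin : FiniteDimensional ℝ H := finiteDimensional_of_finite
  have hdev : ∀ ω, ¬ AccurateBefore f lam rho B delta D P n ω → ∃ t < n,
      rho ^ 2 * (logVolume lam (pairFeature H (P.x1 ω) (P.x2 ω)) t + 2 * Real.log (1 / delta)) +
        D ^ 2 / 64 < noiseForm lam (pairFeature H (P.x1 ω) (P.x2 ω)) (fun s => P.noise s ω) t := by
    intro ω hω
    simp only [AccurateBefore] at hω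
    push Not at hω
    obtain ⟨t, ht, x, z, hxz⟩ := hω
    exact ⟨t, ht, (hrun.fhat_spec t ω).noiseForm_gt hk hlam hrho hd0 hd1 hD hf
      (fun s _ => P.feedback_smul f ω s) hxz⟩
  -- For n = 1 only the first estimate occurs; it uses no data, so the aggregated noise is zero and
  -- no violation is possible. The margin estimate needs n ≥ 2.
  rcases hn.eq_or_lt with rfl | hn2
  · have hempty : {ω | ¬ AccurateBefore f lam rho B delta D P 1 ω ∧
        C * D⁻¹ * beta H lam rho B delta (P.x1 ω) (P.x2 ω) (1 - 1) *
        (totalGain H lam (P.x1 ω) (P.x2 ω) 1 + Real.log ((1 : ℕ) / delta)) <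
          duelRegret f xstar P 1 ω} = ∅ := by
      refine Set.eq_empty_of_forall_notMem fun ω hω => ?_
      obtain ⟨t, ht, h⟩ := hdev ω hω.1
      obtain rfl : t = 0 := by omega
      have hl : 0 < Real.log (1 / delta) := Real.log_pos (by rw [lt_div_iff₀ hd0]; linarith)
      have hq : noiseForm lam (pairFeature H (P.x1 ω) (P.x2 ω)) (fun s => P.noise s ω) 0 = 0 := by
        simp [noiseForm, noiseSum]
      rw [hq, logVolume, Finset.sum_range_zero] at h
      have : 0 ≤ rho ^ 2 * (0 + 2 * Real.log (1 / delta)) + D ^ 2 / 64 := by positivity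
      linarith
    rw [hempty, measureReal_empty, zero_add, Nat.cast_one, div_one]
    exact pow_le_of_le_one hd0.le hd1.le (by norm_num)
  · refine le_trans (add_le_add (measureReal_mono ?_) le_rfl)
      (measure_deviation_add_le (ℱ := ℱ) (𝒢 := fun t => ℱ t ⊔ MeasurableSpace.comap (P.b t) ⊤)
        (fun t => le_sup_left) hrun.sup_comap_le
        (φ := fun ω => pairFeature H (P.x1 ω) (P.x2 ω)) hrun.measurable_pairFeature
        (ξ := P.noise) hrun.noise_meas hnoise (fun ω t => norm_feature_sub_le hk _ _)
        hrho rfl hD hlam hd0 hd1 hn2)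
    rintro ω ⟨h1, h2⟩
    obtain ⟨t, ht, h⟩ := hdev ω h1
    exact ⟨t, ht.le, h, coefficient_le_of_regret_gt hk hf hD hC hDx hlam hrho hd0 hd1 hn2 h2 ht⟩

/-- The regret bound of approximate information-directed sampling. -/
theorem IsRun.regret_bound [Finite X] [IsProbabilityMeasure μ]
    (hrun : IsRun μ ℱ f lam rho B delta P) (hnoise : HasSubGaussianNoise μ ℱ rho P)
    (hk : ∀ x : X, kern H x x ≤ 1) (hf : ‖f‖ ≤ B) {xstar : X}
    (hstar : ∀ x : X, x ≠ xstar → f x < f xstar) {D : ℝ}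
    (hgap : IsLeast {g : ℝ | ∃ x : X, x ≠ xstar ∧ g = gap f xstar x} D) (hlam : 1 ≤ lam)
    (hrho : 0 ≤ rho) (hd0 : 0 < delta) (hd1 : delta < 1) {n : ℕ} (hn : 1 ≤ n) :
    1 - delta ≤ μ.real {ω | duelRegret f xstar P n ω ≤
      19200 * D⁻¹ * beta H lam rho B delta (P.x1 ω) (P.x2 ω) (n - 1) *
        (totalGain H lam (P.x1 ω) (P.x2 ω) n + Real.log (n / delta))} := by
  have hfin : FiniteDimensional ℝ H := finiteDimensional_of_finite
  have hlam0 : 0 < lam := by linarith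
  have hB : 0 ≤ B := (norm_nonneg f).trans hf
  obtain ⟨x, hx, hDx⟩ := hgap.1
  have hD : 0 < D := by
    rw [hDx, gap]
    exact sub_pos.2 (hstar x hx)
  have hDle : ∀ y, y ≠ xstar → D ≤ gap f xstar y := fun y hy => hgap.2 ⟨y, hy, rfl⟩
  have hnpos : (0 : ℝ) < n := by exact_mod_cast hn
  set I : ℕ → Ω → ℝ := fun t ω => infoGain H lam (P.x1 ω) (P.x2 ω) t (P.xhat t ω) (P.z t ω)
  set good := {ω | duelRegret f xstar P n ω ≤
      19200 * D⁻¹ * beta H lam rho B delta (P.x1 ω) (P.x2 ω) (n - 1) *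
        (totalGain H lam (P.x1 ω) (P.x2 ω) n + Real.log (n / delta))} with hgood
  set E₁ := {ω | ¬ AccurateBefore f lam rho B delta D P n ω ∧
      19200 * D⁻¹ * beta H lam rho B delta (P.x1 ω) (P.x2 ω) (n - 1) *
        (totalGain H lam (P.x1 ω) (P.x2 ω) n + Real.log (n / delta)) < duelRegret f xstar P n ω}
  have hE₁ : μ.real E₁ + (delta / n) ^ 40 ≤ delta :=
    hrun.measure_inaccurate_add_le hnoise hk hf hD (by norm_num) hDx hlam hrho hd0 hd1 hn
  set E₂ := {ω | 3 * (∑ s ∈ Finset.range n, bit (P.b s ω) * I s ω + 40 * Real.log (n / delta)) ≤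
      ∑ s ∈ Finset.range n, P.p s ω * I s ω}
  have hE₂ : μ.real E₂ ≤ (delta / n) ^ 40 := by
    refine (measure_bernoulli_le hrun.b_meas hrun.p_meas hrun.p_mem hrun.b_law
      (hrun.measurable_infoGain hlam0) (fun t ω => ⟨infoGain_nonneg _ _ _ hlam0 _ _,
        infoGain_le hk _ _ _ hlam0 _ _⟩) n (40 * Real.log (n / delta))).trans_eq ?_
    have h1 : -(40 * Real.log (n / delta)) = Real.log ((delta / n) ^ 40) := by
      rw [Real.log_pow, ← inv_div, Real.log_inv]
      push_cast
      ring
    rw [h1, Real.exp_log (by positivity)]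
  -- The bound for a feedback round cancels p, hence fails to apply when p = 0; such feedback rounds
  -- form a null event.
  set E₃ := ⋃ t : ℕ, {ω | P.b t ω = true ∧ P.p t ω = 0}
  have hE₃ : μ.real E₃ = 0 := by
    have : μ E₃ = 0 := measure_iUnion_null fun t =>
      measure_bit_of_param_zero hrun.b_meas hrun.p_meas hrun.b_law t
    rw [measureReal_def, this, ENNReal.toReal_zero]
  have hcover : Set.univ ⊆ good ∪ (E₁ ∪ (E₂ ∪ E₃)) := by
    intro ω _
    by_contra hω
    simp only [Set.mem_union, not_or] at hω
    obtain ⟨h0, h1, h2, h3⟩ := hω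
    have hfail : 19200 * D⁻¹ * beta H lam rho B delta (P.x1 ω) (P.x2 ω) (n - 1) *
        (totalGain H lam (P.x1 ω) (P.x2 ω) n + Real.log (n / delta)) < duelRegret f xstar P n ω :=
      not_le.1 h0
    have hacc : AccurateBefore f lam rho B delta D P n ω := by
      by_contra hcon
      exact h1 ⟨hcon, hfail⟩
    have hpos : ∀ t < n, P.b t ω = true → 0 < P.p t ω := by
      intro t _ hb
      refine lt_of_le_of_ne (hrun.p_mem t ω).1 fun hp => h3 ?_
      exact Set.mem_iUnion.2 ⟨t, hb, hp.symm⟩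
    have hreg := hrun.duelRegret_le_of_accurate hk hB hlam0 hrho hD hDle hacc hpos
    have h2' : ∑ s ∈ Finset.range n, P.p s ω * I s ω <
        3 * (∑ s ∈ Finset.range n, bit (P.b s ω) * I s ω + 40 * Real.log (n / delta)) :=
      not_le.1 h2
    rw [totalGain_eq] at hfail
    change _ < _ at hfail
    set γ := ∑ s ∈ Finset.range n, bit (P.b s ω) * I s ω with hγ
    change D * _ ≤ _ * (γ + ∑ s ∈ Finset.range n, P.p s ω * I s ω) at hreg
    have hγ0 : 0 ≤ γ := Finset.sum_nonneg fun s _ =>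
      mul_nonneg (bit_nonneg _) (infoGain_nonneg _ _ _ hlam0 _ _)
    have hβ0 : 0 ≤ beta H lam rho B delta (P.x1 ω) (P.x2 ω) (n - 1) := sq_nonneg _
    set β := beta H lam rho B delta (P.x1 ω) (P.x2 ω) (n - 1)
    have h4 : D * duelRegret f xstar P n ω ≤ 19200 * β * (γ + Real.log (n / delta)) := by
      refine hreg.trans ?_
      -- γ + 3(γ + 40 log(n/δ)) ≤ 120(γ + log(n/δ)), and 160 · 120 = 19200.
      calc 160 * β * (γ + ∑ s ∈ Finset.range n, P.p s ω * I s ω)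
          ≤ 160 * β * (120 * (γ + Real.log (n / delta))) := by gcongr; linarith
        _ = _ := by ring
    have h5 : 19200 * D⁻¹ * β * (γ + Real.log (n / delta)) =
        19200 * β * (γ + Real.log (n / delta)) / D := by field_simp
    change 19200 * D⁻¹ * β * (γ + Real.log (n / delta)) < _ at hfail
    rw [h5, div_lt_iff₀ hD] at hfail
    linarith
  have h1 : 1 ≤ μ.real good + (μ.real E₁ + (μ.real E₂ + μ.real E₃)) := by
    calc (1 : ℝ) = μ.real Set.univ := by simp
      _ ≤ μ.real (good ∪ (E₁ ∪ (E₂ ∪ E₃))) := measureReal_mono hcover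
      _ ≤ _ := (measureReal_union_le _ _).trans (add_le_add le_rfl
        ((measureReal_union_le _ _).trans (add_le_add le_rfl (measureReal_union_le _ _))))
  linarith

end Run

end DuelingIDS

end

theorem theorem2 :
    -- one universal constant, independent of the problem, of `δ` and of `n`
    ∃ C : ℝ, 0 < C ∧
      ∀ (X : Type*) [Finite X]
        (H : Type*) [NormedAddCommGroup H] [InnerProductSpace ℝ H] [CompleteSpace H]
        [RKHS ℝ H X ℝ]
        (_hk : ∀ x : X, DuelingIDS.kern H x x ≤ 1)
        (f : H) (B : ℝ) (_hf : ‖f‖ ≤ B)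
        (xstar : X) (_hstar : ∀ x : X, x ≠ xstar → f x < f xstar)
        (gapMin : ℝ)
        (_hgap : IsLeast {g : ℝ | ∃ x : X, x ≠ xstar ∧ g = DuelingIDS.gap f xstar x} gapMin)
        (lam rho delta : ℝ) (_hlam : 1 ≤ lam) (_hrho : 0 ≤ rho)
        (_hdelta : 0 < delta) (_hdelta' : delta < 1)
        (Ω : Type*) [mΩ : MeasurableSpace Ω] (μ : MeasureTheory.Measure Ω)
        [MeasureTheory.IsProbabilityMeasure μ] (ℱ : MeasureTheory.Filtration ℕ mΩ)
        (P : DuelingIDS.Interaction Ω X H)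
        (_hrun : DuelingIDS.IsRun μ ℱ f lam rho B delta P)
        (_hnoise : DuelingIDS.HasSubGaussianNoise μ ℱ rho P)
        (n : ℕ) (_hn : 1 ≤ n),
        1 - delta ≤ μ.real {ω |
          DuelingIDS.duelRegret f xstar P n ω ≤
            C * gapMin⁻¹ *
              -- the coefficient of the last round, computed from the first `n - 1` pairs
              DuelingIDS.beta H lam rho B delta (P.x1 ω) (P.x2 ω) (n - 1) *
              (DuelingIDS.totalGain H lam (P.x1 ω) (P.x2 ω) n + Real.log (n / delta))} := by
  refine ⟨19200, by norm_num, ?_⟩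
  intro X _ H _ _ _ _ hk f B hf xstar hstar D hgap lam rho delta hlam hrho hd0 hd1 Ω _ μ _ ℱ P
    hrun hnoise n hn
  exact hrun.regret_bound hnoise hk hf hstar hgap hlam hrho hd0 hd1 hn
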